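/- Let $(M,g)$ be a connected smooth four-dimensional Riemannian manifold (without boundary), with Levi-Civita connection $\nabla$ and curvature tensor $R(X,Y)Z=\nabla_X\nabla_YZ-\nabla_Y\nabla_XZ-\nabla_{[X,Y]}Z$, and write $R(X,Y,Z,U)=g(R(X,Y)Z,U)$. For a tangent vector $X\in T_pM$ let $\mathcal J(X):T_pM\to T_pM$, $\mathcal J(X)U=R(U,X)X$, be the Jacobi operator, and for a linear subspace $\pi\subseteq T_pM$ let $\mathcal J(\pi)=\sum_i\mathcal J(Y_i)$ be the higher order Jacobi operator, where $\{Y_i\}$ is any orthonormal basis of $\pi$ (the operator does not depend on the basis). Assume that $(M,g)$ is indecomposable in the following sense: for every $p\in M$ there is no orthogonal decomposition $T_pM=V_1\oplus V_2$ with $V_1,V_2\neq 0$ for which the curvature tensor splits as $R_p=R_1\oplus R_2$ with $R_i$ a tensor on $V_i$, i.e. $R_p(X,Y,Z,U)=R_p(X_1,Y_1,Z_1,U_1)+R_p(X_2,Y_2,Z_2,U_2)$ for all $X,Y,Z,U\in T_pM$, where $X_i$ denotes the $V_i$-component of $X$, and similarly for $Y$, $Z$, $U$. Then the following are equivalent: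 (a) $\mathcal J(X)\circ\mathcal J(X^\perp)=\mathcal J(X^\perp)\circ\mathcal J(X)$ for every $p\in M$ and every unit vector $X\in T_pM$, where $X^\perp$ is the orthogonal complement of $X$ in $T_pM$; (b) $\mathcal J(\alpha)\circ\mathcal J(\alpha^\perp)=\mathcal J(\alpha^\perp)\circ\mathcal J(\alpha)$ for every $p\in M$ and every $2$-plane $\alpha\subset T_pM$, where $\alpha^\perp$ is the orthogonal complement of $\alpha$ in $T_pM$; (c) $(M,g)$ is Einstein: there is a constant $\lambda\in\mathbb R$ with $\rho=\lambda g$ on all of $M$, where $\rho(Y,Z)=\operatorname{tr}(X\mapsto R(X,Y)Z)$ is the Ricci tensor. -/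

import Mathlib

set_option maxSynthPendingDepth 3

open scoped Manifold ContDiff

noncomputable section

namespace RiemGeom

section Coordinates

/-! ### Levi-Civita connection and curvature of a metric on an open piece of a vector space

`E` is the model space, `G : E → E →L[ℝ] E →L[ℝ] ℝ` a field of bilinear forms (the metric in a
chart).  Everything is written without choosing a basis of `E`; on the vectors of a basis one
recovers the usual coordinate formulas. -/

variable {E : Type*} [NormedAddCommGroup E] [NormedSpace ℝ E]

/-- Right-hand side of the Koszul formula for constant vector fields (Christoffel symbols of the
first kind): `(u, v, w) ↦ ½ (∂_u G(v, w) + ∂_v G(u, w) - ∂_w G(u, v))`. -/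
def christoffelFirst (G : E → E →L[ℝ] E →L[ℝ] ℝ) (x : E) : E →L[ℝ] E →L[ℝ] (E →L[ℝ] ℝ) :=
  let D : E →L[ℝ] E →L[ℝ] (E →L[ℝ] ℝ) := fderiv ℝ G x
  let C : (E →L[ℝ] (E →L[ℝ] ℝ)) →L[ℝ] (E →L[ℝ] (E →L[ℝ] ℝ)) :=
    (ContinuousLinearMap.flipₗᵢ ℝ E E ℝ).toContinuousLinearEquiv.toContinuousLinearMap
  (1 / 2 : ℝ) • (D + D.flip - C.comp D.flip)

theorem christoffelFirst_apply (G : E → E →L[ℝ] E →L[ℝ] ℝ) (x u v w : E) :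
    christoffelFirst G x u v w =
      1 / 2 * (fderiv ℝ G x u v w + fderiv ℝ G x v u w - fderiv ℝ G x w u v) := rfl

/-- Christoffel symbols of the second kind, as a bilinear map: `christoffel G x u v = ∇_u v` at `x`
for constant vector fields `u, v`.  It is the vector that represents the functional
`christoffelFirst G x u v` with respect to the (invertible) form `G x`. -/
def christoffel (G : E → E →L[ℝ] E →L[ℝ] ℝ) (x : E) : E →L[ℝ] E →L[ℝ] E :=
  (ContinuousLinearMap.compL ℝ E (E →L[ℝ] ℝ) E (G x).inverse).comp (christoffelFirst G x)

theorem christoffel_apply (G : E → E →L[ℝ] E →L[ℝ] ℝ) (x u v : E) :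
    christoffel G x u v = (G x).inverse (christoffelFirst G x u v) := rfl

theorem apply_christoffel {G : E → E →L[ℝ] E →L[ℝ] ℝ} {x : E} (h : (G x).IsInvertible)
    (u v w : E) : G x (christoffel G x u v) w = christoffelFirst G x u v w := by
  obtain ⟨e, he⟩ := h
  rw [christoffel_apply, ← he]
  simp

/-- The connection `christoffel G` is torsion-free when `G` is symmetric. -/
theorem christoffel_symm {G : E → E →L[ℝ] E →L[ℝ] ℝ} {x : E}
    (hs : ∀ u v w, fderiv ℝ G x u v w = fderiv ℝ G x u w v) (u v : E) :
    christoffel G x u v = christoffel G x v u := by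
  rw [christoffel_apply, christoffel_apply]
  congr 1
  ext w
  rw [christoffelFirst_apply, christoffelFirst_apply, hs w u v]
  ring

/-- The connection `christoffel G` is compatible with the metric `G`. -/
theorem christoffel_metric {G : E → E →L[ℝ] E →L[ℝ] ℝ} {x : E} (h : (G x).IsInvertible)
    (hs : ∀ u v w, fderiv ℝ G x u v w = fderiv ℝ G x u w v) (u v w : E) :
    fderiv ℝ G x u v w =
      G x (christoffel G x u v) w + G x (christoffel G x u w) v := by
  rw [apply_christoffel h, apply_christoffel h, christoffelFirst_apply, christoffelFirst_apply,
    hs u w v, hs v u w, hs w u v]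
  ring

/-- Curvature in coordinates: `R(u, v) w = ∇_u ∇_v w - ∇_v ∇_u w` for constant vector fields
`u, v, w` (whose brackets vanish), that is
`∂_u Γ(v, w) - ∂_v Γ(u, w) + Γ(u, Γ(v, w)) - Γ(v, Γ(u, w))`. -/
def coordCurvature (G : E → E →L[ℝ] E →L[ℝ] ℝ) (x : E) : E →L[ℝ] E →L[ℝ] E →L[ℝ] E :=
  let D : E →L[ℝ] E →L[ℝ] (E →L[ℝ] E) := fderiv ℝ (christoffel G) x
  let Q : E →L[ℝ] E →L[ℝ] (E →L[ℝ] E) :=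
    (ContinuousLinearMap.compL ℝ E E E).bilinearComp (christoffel G x) (christoffel G x)
  D - D.flip + (Q - Q.flip)

theorem coordCurvature_apply (G : E → E →L[ℝ] E →L[ℝ] ℝ) (x u v w : E) :
    coordCurvature G x u v w =
      fderiv ℝ (christoffel G) x u v w - fderiv ℝ (christoffel G) x v u w +
        (christoffel G x u (christoffel G x v w) -
          christoffel G x v (christoffel G x u w)) := rfl

end Coordinates

section Manifold

/-! ### Curvature of a Riemannian manifold

`M` is a manifold without boundary modelled on `E`, with an inner product on each tangent space. -/

open scoped Bundle

variable {E : Type*} [NormedAddCommGroup E] [NormedSpace ℝ E]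
  {M : Type*} [TopologicalSpace M] [ChartedSpace E M]

/-- The differential at `p` of the preferred chart around `p`. -/
def chartDeriv (p : M) : TangentSpace 𝓘(ℝ, E) p →L[ℝ] E :=
  mfderiv 𝓘(ℝ, E) 𝓘(ℝ, E) (extChartAt 𝓘(ℝ, E) p) p

/-- The differential at `x` of the inverse of the preferred chart around `p`. -/
def chartSymmDeriv (p : M) (x : E) :
    E →L[ℝ] TangentSpace 𝓘(ℝ, E) ((extChartAt 𝓘(ℝ, E) p).symm x) :=
  mfderiv 𝓘(ℝ, E) 𝓘(ℝ, E) (extChartAt 𝓘(ℝ, E) p).symm x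

variable [Bundle.RiemannianBundle (fun x : M ↦ TangentSpace 𝓘(ℝ, E) x)]

/-- The metric read in the preferred chart `φ` around `p`:
`x ↦ ((u, v) ↦ g (dφ⁻¹ u) (dφ⁻¹ v))`, on the target of `φ`. -/
def chartMetric (p : M) (x : E) : E →L[ℝ] E →L[ℝ] ℝ :=
  (innerSL ℝ (E := TangentSpace 𝓘(ℝ, E) ((extChartAt 𝓘(ℝ, E) p).symm x))).bilinearComp
    (chartSymmDeriv p x) (chartSymmDeriv p x)

theorem chartMetric_apply (p : M) (x u v : E) :
    chartMetric p x u v = inner ℝ (chartSymmDeriv p x u) (chartSymmDeriv p x v) := rfl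

/-- The `(1,3)` curvature tensor `R(X, Y) Z` of the Levi-Civita connection at `p`, computed in the
preferred chart `φ` around `p` and carried back to the tangent space at `p` by `dφ`. -/
def curvature (p : M) (X Y Z : TangentSpace 𝓘(ℝ, E) p) : TangentSpace 𝓘(ℝ, E) p :=
  (chartDeriv p).inverse
    (coordCurvature (chartMetric p) (extChartAt 𝓘(ℝ, E) p p)
      (chartDeriv p X) (chartDeriv p Y) (chartDeriv p Z))

/-- The linear map `X ↦ R(X, Y) Z` of the tangent space at `p`. -/
def curvatureEnd (p : M) (Y Z : TangentSpace 𝓘(ℝ, E) p) :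
    Module.End ℝ (TangentSpace 𝓘(ℝ, E) p) where
  toFun X := curvature p X Y Z
  map_add' X X' := by simp [curvature]
  map_smul' c X := by simp [curvature]

/-- The `(0,4)` curvature tensor `R(X, Y, Z, U) = g(R(X, Y) Z, U)`. -/
def curvatureForm (p : M) (X Y Z U : TangentSpace 𝓘(ℝ, E) p) : ℝ :=
  inner ℝ (curvature p X Y Z) U

/-- The Ricci tensor `ρ(Y, Z)`, the trace of `X ↦ R(X, Y) Z`. -/
def ricci (p : M) (Y Z : TangentSpace 𝓘(ℝ, E) p) : ℝ :=
  LinearMap.trace ℝ (TangentSpace 𝓘(ℝ, E) p) (curvatureEnd p Y Z)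

/-- The Jacobi operator `J(X) : U ↦ R(U, X) X`. -/
def jacobi (p : M) (X : TangentSpace 𝓘(ℝ, E) p) : Module.End ℝ (TangentSpace 𝓘(ℝ, E) p) :=
  curvatureEnd p X X

section HigherJacobi

theorem sum_bilin_orthonormalBasis {V F : Type*} [NormedAddCommGroup V] [InnerProductSpace ℝ V]
    [AddCommGroup F] [Module ℝ F] {ι κ : Type*} [Fintype ι] [Fintype κ] (B : V →ₗ[ℝ] V →ₗ[ℝ] F)
    (b : OrthonormalBasis ι ℝ V) (c : OrthonormalBasis κ ℝ V) :
    ∑ i, B (b i) (b i) = ∑ k, B (c k) (c k) := by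
  classical
  have h1 : ∀ i, B (b i) (b i) =
      ∑ j, ∑ k, (inner ℝ (c j) (b i) * inner ℝ (b i) (c k)) • B (c j) (c k) := by
    intro i
    conv_lhs => rw [← c.sum_repr' (b i)]
    simp only [map_sum, LinearMap.sum_apply, map_smul, LinearMap.smul_apply,
      Finset.smul_sum, smul_smul]
    rw [Finset.sum_comm]
    refine Finset.sum_congr rfl fun j _ ↦ Finset.sum_congr rfl fun k _ ↦ ?_
    rw [real_inner_comm (b i) (c k), mul_comm]
  simp only [h1]
  rw [Finset.sum_comm]
  refine Finset.sum_congr rfl fun j _ ↦ ?_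
  rw [Finset.sum_comm]
  simp only [← Finset.sum_smul, b.sum_inner_mul_inner, c.inner_eq_ite, ite_smul, one_smul,
    zero_smul, Finset.sum_ite_eq, Finset.mem_univ, if_true]

variable [FiniteDimensional ℝ E]

instance (p : M) : FiniteDimensional ℝ (TangentSpace 𝓘(ℝ, E) p) := ‹FiniteDimensional ℝ E›

/-- The higher order Jacobi operator `J(W) = ∑ᵢ J(Yᵢ)` of a subspace `W` of the tangent space,
`(Yᵢ)` an orthonormal basis of `W`. -/
def higherJacobi (p : M) (W : Submodule ℝ (TangentSpace 𝓘(ℝ, E) p)) :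
    Module.End ℝ (TangentSpace 𝓘(ℝ, E) p) :=
  ∑ i, jacobi p (stdOrthonormalBasis ℝ W i : TangentSpace 𝓘(ℝ, E) p)

/-- `J(W)` can be computed in any orthonormal basis of `W`. -/
theorem higherJacobi_eq_sum {ι : Type*} [Fintype ι] (p : M)
    (W : Submodule ℝ (TangentSpace 𝓘(ℝ, E) p)) (b : OrthonormalBasis ι ℝ W) :
    higherJacobi p W = ∑ i, jacobi p (b i : TangentSpace 𝓘(ℝ, E) p) := by
  let B : W →ₗ[ℝ] W →ₗ[ℝ] Module.End ℝ (TangentSpace 𝓘(ℝ, E) p) :=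
    LinearMap.mk₂ ℝ (fun Y Z : W ↦ curvatureEnd p (Y : TangentSpace 𝓘(ℝ, E) p) Z)
      (fun Y Y' Z ↦ by ext X; simp [curvatureEnd, curvature])
      (fun c Y Z ↦ by ext X; simp [curvatureEnd, curvature])
      (fun Y Z Z' ↦ by ext X; simp [curvatureEnd, curvature])
      (fun c Y Z ↦ by ext X; simp [curvatureEnd, curvature])
  exact sum_bilin_orthonormalBasis B (stdOrthonormalBasis ℝ W) b

end HigherJacobi

variable (E M) in
/-- The metric is Einstein: `ρ = c g` for a constant `c`. -/
def IsEinstein : Prop :=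
  ∃ c : ℝ, ∀ (p : M) (Y Z : TangentSpace 𝓘(ℝ, E) p), ricci p Y Z = c * inner ℝ Y Z

/-- The curvature model `(T_pM, g_p, R_p)` is decomposable: there is a non-trivial orthogonal
decomposition `T_pM = W ⊕ Wᗮ` such that `R_p` is the direct sum of a tensor on `W` and a tensor on
`Wᗮ` (which then are the restrictions of `R_p`). -/
def IsDecomposableAt [FiniteDimensional ℝ E] (p : M) : Prop :=
  ∃ W : Submodule ℝ (TangentSpace 𝓘(ℝ, E) p), W ≠ ⊥ ∧ W ≠ ⊤ ∧
    ∀ X Y Z U : TangentSpace 𝓘(ℝ, E) p,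
      curvatureForm p X Y Z U =
        curvatureForm p (W.starProjection X) (W.starProjection Y)
          (W.starProjection Z) (W.starProjection U) +
        curvatureForm p (Wᗮ.starProjection X) (Wᗮ.starProjection Y)
          (Wᗮ.starProjection Z) (Wᗮ.starProjection U)

variable (E M) in
/-- The manifold is indecomposable: its curvature model at every point is indecomposable. -/
def IsIndecomposable [FiniteDimensional ℝ E] : Prop :=
  ∀ p : M, ¬ IsDecomposableAt (E := E) p

end Manifold

end RiemGeom

end

open scoped Bundle

/-!
The operator `ρ = J(T_pM)` is the Ricci operator, and `J(W) + J(Wᗮ) = ρ` for every subspace `W`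
(`higherJacobi_add_orthogonal`, `inner_higherJacobi_top`). Hence `J(W)` commutes with `J(Wᗮ)` if and
only if it commutes with `ρ`. In particular all these operators commute on an Einstein manifold.
If the `J(α)` of all planes commute with `ρ`, so do the Jacobi operators of unit vectors, since
`2 J(X) = J(X, Y) + J(X, Z) - J(Y, Z)` for orthonormal `X, Y, Z`.

Conversely, suppose that all Jacobi operators at `p` commute with `ρ`, and let `W` be an eigenspace
of `ρ`. Then `J(X)` preserves `W` and `Wᗮ`, that is, `R(A, X, X, B) = 0` for `A ∈ W`, `B ∈ Wᗮ`. By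
polarization and the first Bianchi identity every component of `R` with arguments in both `W` and
`Wᗮ` vanishes, so `R` splits along `W ⊕ Wᗮ` (`IsAlgCurvature.eq_add_of_jacobi_eq_zero`). As the
curvature is indecomposable, `W = T_pM`, and `ρ` is a multiple `l(p)` of the identity
(`exists_ricci_eq_of_commute`).

That `l` is constant is Schur's lemma. Since the curvature at `q` is defined in the preferred chart
around `q`, its naturality under changes of coordinates (`IsPullbackMetric.apply_coordCurvature`)
is needed to see `Ric = l g` in one chart on a neighbourhood of a point. There, the second Bianchi
identity contracted twice gives `(n - 2) dl = 0`
(`IsSmoothMetricOn.fderiv_eq_zero_of_ricci_eq`). So `l` is locally constant, and `M` is connected.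
-/

open scoped Bundle
open RiemGeom Filter Topology

/-! ### Algebraic curvature tensors -/

section Algebra

variable {V : Type*} [NormedAddCommGroup V] [InnerProductSpace ℝ V]

/-- A quadrilinear form with the symmetries of a Riemannian curvature tensor. -/
structure IsAlgCurvature (R : V →ₗ[ℝ] V →ₗ[ℝ] V →ₗ[ℝ] V →ₗ[ℝ] ℝ) : Prop where
  swap_left : ∀ X Y Z U, R X Y Z U = -R Y X Z U
  swap_right : ∀ X Y Z U, R X Y Z U = -R X Y U Z
  bianchi : ∀ X Y Z U, R X Y Z U + R Y Z X U + R Z X Y U = 0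

namespace IsAlgCurvature

variable {R : V →ₗ[ℝ] V →ₗ[ℝ] V →ₗ[ℝ] V →ₗ[ℝ] ℝ}

theorem pair_symm (h : IsAlgCurvature R) (X Y Z U : V) : R X Y Z U = R Z U X Y := by
  have h1 := h.bianchi X Y Z U
  have h2 := h.bianchi Y Z U X
  have h3 := h.bianchi Z U X Y
  have h4 := h.bianchi U X Y Z
  linarith [h.swap_right X Y Z U, h.swap_right Y Z X U, h.swap_right Z X Y U,
    h.swap_right Z U Y X, h.swap_right U Y Z X, h.swap_right U X Z Y, h.swap_right X Z U Y,
    h.swap_left X Y U Z, h.swap_left U Y X Z, h.swap_left X Z Y U, h.swap_left X Z U Y,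
    h.swap_left Y U X Z, h.swap_right X U Y Z, h.swap_left X U Y Z, h.swap_right Y U X Z,
    h.swap_left Y U Z X, h.swap_right Z U X Y]

/-- If the Jacobi operators preserve an orthogonal splitting `W ⊕ Wᗮ`, that is, if
`R(A, X, X, B) = 0` for `A ∈ W` and `B ∈ Wᗮ`, then `R(A, X, Y, B) = 0` for all `X, Y`. -/
theorem eq_zero_of_jacobi_eq_zero (h : IsAlgCurvature R) {W : Submodule ℝ V}
    [W.HasOrthogonalProjection]
    (hW : ∀ A ∈ W, ∀ B ∈ Wᗮ, ∀ X, R A X X B = 0) {A B : V} (hA : A ∈ W) (hB : B ∈ Wᗮ)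
    (X Y : V) : R A X Y B = 0 := by
  have alt : ∀ A ∈ W, ∀ B ∈ Wᗮ, ∀ X Y, R A X Y B = -R A Y X B := by
    intro A hA B hB X Y
    have := hW A hA B hB (X + Y)
    simp only [map_add, LinearMap.add_apply, hW A hA B hB] at this
    linarith
  have alt' : ∀ A ∈ W, ∀ B ∈ Wᗮ, ∀ X Y, R B X Y A = -R B Y X A := by
    intro A hA B hB X Y
    linarith [alt A hA B hB X Y, h.pair_symm B X Y A, h.pair_symm B Y X A,
      h.swap_left Y A B X, h.swap_right A Y B X, h.swap_left X A B Y, h.swap_right A X B Y]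
  -- for `X ∈ W` the alternation holds for the outer pair `(A, B)` as well as for `(X, B)`;
  -- together with the Bianchi identity this kills the component
  have key : ∀ A ∈ W, ∀ B ∈ Wᗮ, ∀ X ∈ W, ∀ Y, R A X Y B = 0 := by
    intro A hA B hB X hX Y
    linarith [alt A hA B hB X Y, alt X hX B hB A Y, h.swap_left A X Y B, h.swap_left A Y X B,
      h.swap_left X Y A B, h.bianchi A X Y B]
  have key' : ∀ A ∈ W, ∀ B ∈ Wᗮ, ∀ X, ∀ Y ∈ Wᗮ, R A X Y B = 0 := by
    intro A hA B hB X Y hY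
    have e : ∀ A X Y B, R A X Y B = R B Y X A := fun A X Y B ↦ by
      linarith [h.pair_symm A X Y B, h.swap_left Y B A X, h.swap_right B Y A X]
    rw [e]
    linarith [alt' A hA B hB Y X, alt' A hA Y hY B X, h.swap_left B Y X A, h.swap_left B X Y A,
      h.swap_left Y X B A, h.bianchi B Y X A]
  have split : ∀ X, W.starProjection X + Wᗮ.starProjection X = X := fun X ↦
    Submodule.starProjection_add_starProjection_orthogonal (K := W) X
  rw [← split X, ← split Y]
  simp only [map_add, LinearMap.add_apply]
  have m1 : ∀ X, W.starProjection X ∈ W := fun X ↦ Submodule.starProjection_apply_mem _ _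
  have m2 : ∀ X, Wᗮ.starProjection X ∈ Wᗮ := fun X ↦ Submodule.starProjection_apply_mem _ _
  rw [key A hA B hB _ (m1 X), key A hA B hB _ (m1 X), key' A hA B hB _ _ (m2 Y),
    alt A hA B hB, key A hA B hB _ (m1 Y)]
  simp

/-- Under the hypothesis of `eq_zero_of_jacobi_eq_zero` the whole tensor splits. -/
theorem eq_add_of_jacobi_eq_zero (h : IsAlgCurvature R) {W : Submodule ℝ V}
    [W.HasOrthogonalProjection]
    (hW : ∀ A ∈ W, ∀ B ∈ Wᗮ, ∀ X, R A X X B = 0) (X Y Z U : V) :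
    R X Y Z U =
      R (W.starProjection X) (W.starProjection Y) (W.starProjection Z) (W.starProjection U) +
      R (Wᗮ.starProjection X) (Wᗮ.starProjection Y) (Wᗮ.starProjection Z)
        (Wᗮ.starProjection U) := by
  have split : ∀ X, W.starProjection X + Wᗮ.starProjection X = X := fun X ↦
    Submodule.starProjection_add_starProjection_orthogonal (K := W) X
  have m1 : ∀ X, W.starProjection X ∈ W := fun X ↦ Submodule.starProjection_apply_mem _ _
  have m2 : ∀ X, Wᗮ.starProjection X ∈ Wᗮ := fun X ↦ Submodule.starProjection_apply_mem _ _
  -- `zij`: no component has an argument of `W` in place `i` and one of `Wᗮ` in place `j`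
  have z14 : ∀ A ∈ W, ∀ B ∈ Wᗮ, ∀ X Y, R A X Y B = 0 := fun A hA B hB X Y ↦
    h.eq_zero_of_jacobi_eq_zero hW hA hB X Y
  have z13 : ∀ A ∈ W, ∀ B ∈ Wᗮ, ∀ X Y, R A X B Y = 0 := fun A hA B hB X Y ↦ by
    rw [h.swap_right, z14 A hA B hB, neg_zero]
  have z24 : ∀ A ∈ W, ∀ B ∈ Wᗮ, ∀ X Y, R X A Y B = 0 := fun A hA B hB X Y ↦ by
    rw [h.swap_left, z14 A hA B hB, neg_zero]
  have z23 : ∀ A ∈ W, ∀ B ∈ Wᗮ, ∀ X Y, R X A B Y = 0 := fun A hA B hB X Y ↦ by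
    rw [h.swap_left, z13 A hA B hB, neg_zero]
  have z12 : ∀ A ∈ W, ∀ B ∈ Wᗮ, ∀ X Y, R A B X Y = 0 := fun A hA B hB X Y ↦ by
    linarith [h.bianchi A B X Y, z24 A hA B hB X Y, h.pair_symm B X A Y,
      z13 A hA B hB Y X, h.swap_right X A B Y, h.swap_left X A B Y, z13 A hA B hB X Y]
  have left : ∀ A ∈ W, ∀ Y Z U, R A Y Z U =
      R A (W.starProjection Y) (W.starProjection Z) (W.starProjection U) := by
    intro A hA Y Z U
    conv_lhs => rw [← split Y, ← split Z, ← split U]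
    simp only [map_add, LinearMap.add_apply, z12 A hA _ (m2 Y), z13 A hA _ (m2 Z),
      z14 A hA _ (m2 U), add_zero]
  have right : ∀ B ∈ Wᗮ, ∀ Y Z U, R B Y Z U =
      R B (Wᗮ.starProjection Y) (Wᗮ.starProjection Z) (Wᗮ.starProjection U) := by
    intro B hB Y Z U
    have y12 : ∀ A ∈ W, ∀ X Y, R B A X Y = 0 := fun A hA X Y ↦ by
      rw [h.swap_left, z12 A hA B hB, neg_zero]
    have y13 : ∀ A ∈ W, ∀ X Y, R B X A Y = 0 := fun A hA X Y ↦ by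
      rw [h.pair_symm, z13 A hA B hB]
    have y14 : ∀ A ∈ W, ∀ X Y, R B X Y A = 0 := fun A hA X Y ↦ by
      rw [h.pair_symm, z23 A hA B hB]
    conv_lhs => rw [← split Y, ← split Z, ← split U]
    simp only [map_add, LinearMap.add_apply, y12 _ (m1 Y), y13 _ (m1 Z), y14 _ (m1 U), zero_add]
  conv_lhs => rw [← split X]
  rw [map_add, LinearMap.add_apply, LinearMap.add_apply, LinearMap.add_apply,
    left _ (m1 X), right _ (m2 X)]

/-- If a self-adjoint operator `ρ` commutes with all Jacobi operators of `R`, it is a multiple of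
the identity, unless `R` splits: one takes for `W` an eigenspace of `ρ`. -/
theorem exists_eq_smul_or_splits [FiniteDimensional ℝ V] [Nontrivial V] (h : IsAlgCurvature R)
    {ρ : Module.End ℝ V} (hρ : ρ.IsSymmetric) (hc : ∀ A B X, R (ρ A) X X B = R A X X (ρ B)) :
    (∃ c : ℝ, ∀ v, ρ v = c • v) ∨
      ∃ W : Submodule ℝ V, W ≠ ⊥ ∧ W ≠ ⊤ ∧ ∀ X Y Z U, R X Y Z U =
        R (W.starProjection X) (W.starProjection Y) (W.starProjection Z) (W.starProjection U) +
        R (Wᗮ.starProjection X) (Wᗮ.starProjection Y) (Wᗮ.starProjection Z)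
          (Wᗮ.starProjection U) := by
  obtain ⟨c, hcev⟩ : ∃ c : ℝ, Module.End.HasEigenvalue ρ c :=
    ⟨_, hρ.hasEigenvalue_iSup_of_finiteDimensional⟩
  set W := Module.End.eigenspace ρ c with hWdef
  have memW : ∀ v, v ∈ W ↔ ρ v = c • v := fun v ↦ Module.End.mem_eigenspace_iff
  by_cases htop : W = ⊤
  · exact .inl ⟨c, fun v ↦ (memW v).1 (htop ▸ Submodule.mem_top)⟩
  refine .inr ⟨W, hcev, htop, h.eq_add_of_jacobi_eq_zero ?_⟩
  intro A hA B hB X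
  -- `Wᗮ`, the orthogonal complement of the kernel of the self-adjoint `ρ - c`, is its range
  have hs : (ρ - c • (1 : Module.End ℝ V)).IsSymmetric := by
    intro v w
    simp [inner_sub_left, inner_sub_right, hρ v w, inner_smul_left, inner_smul_right]
  have hrange : B ∈ LinearMap.range (ρ - c • (1 : Module.End ℝ V)) := by
    have hk : W = LinearMap.ker (ρ - c • (1 : Module.End ℝ V)) := by
      ext v
      simp [memW, sub_eq_zero]
    rw [hk, ← hs.orthogonal_range, Submodule.orthogonal_orthogonal] at hB
    exact hB
  obtain ⟨B', rfl⟩ := hrange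
  have h1 := hc A B' X
  rw [(memW A).1 hA] at h1
  simp only [map_smul, LinearMap.smul_apply, smul_eq_mul] at h1
  simp [h1]

end IsAlgCurvature
end Algebra

/-! ### Symmetries and Bianchi identities of the curvature in coordinates -/

section CoordinateMetric

variable {E : Type*} [NormedAddCommGroup E] [NormedSpace ℝ E]

/-- A smooth field `G` of symmetric nondegenerate bilinear forms on an open set `U` of a vector
space, that is, a pseudo-Riemannian metric on `U`. -/
structure IsSmoothMetricOn (G : E → E →L[ℝ] E →L[ℝ] ℝ) (U : Set E) : Prop where
  isOpen : IsOpen U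
  contDiffOn : ContDiffOn ℝ ∞ G U
  symm : ∀ x ∈ U, ∀ u v, G x u v = G x v u
  isInvertible : ∀ x ∈ U, (G x).IsInvertible

theorem fderiv_eval {F : Type*} [NormedAddCommGroup F] [NormedSpace ℝ F]
    {F' : Type*} [NormedAddCommGroup F'] [NormedSpace ℝ F'] {c : E → F →L[ℝ] F'} {x : E}
    (hc : DifferentiableAt ℝ c x) (u : E) (v : F) :
    fderiv ℝ c x u v = fderiv ℝ (fun y ↦ c y v) x u := by
  rw [fderiv_clm_apply hc (differentiableAt_const v)]
  simp

theorem ContDiffOn.contDiffOn_fderiv {F : Type*} [NormedAddCommGroup F] [NormedSpace ℝ F]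
    {f : E → F} {U : Set E} (hf : ContDiffOn ℝ ∞ f U) (hU : IsOpen U) :
    ContDiffOn ℝ ∞ (fderiv ℝ f) U :=
  hf.fderiv_of_isOpen hU (by simp)

theorem ContDiffOn.differentiableAt_of_isOpen {F : Type*} [NormedAddCommGroup F]
    [NormedSpace ℝ F] {f : E → F} {U : Set E} (hf : ContDiffOn ℝ ∞ f U) (hU : IsOpen U) {x : E}
    (hx : x ∈ U) : DifferentiableAt ℝ f x :=
  (hf.contDiffAt (hU.mem_nhds hx)).differentiableAt (by simp)

theorem ContDiffOn.fderiv_fderiv_comm {F : Type*} [NormedAddCommGroup F]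
    [NormedSpace ℝ F] {f : E → F} {U : Set E} (hf : ContDiffOn ℝ ∞ f U) (hU : IsOpen U) {x : E}
    (hx : x ∈ U) (u v : E) : fderiv ℝ (fderiv ℝ f) x u v = fderiv ℝ (fderiv ℝ f) x v u :=
  (hf.contDiffAt (hU.mem_nhds hx)).isSymmSndFDerivAt (by
    simpa using WithTop.coe_le_coe.2 (le_top : (2 : ℕ∞) ≤ ⊤)) u v

namespace IsSmoothMetricOn

variable {G : E → E →L[ℝ] E →L[ℝ] ℝ} {U : Set E} {x : E}

theorem differentiableAt (hG : IsSmoothMetricOn G U) (hx : x ∈ U) : DifferentiableAt ℝ G x :=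
  hG.contDiffOn.differentiableAt_of_isOpen hG.isOpen hx

theorem fderiv_symm (hG : IsSmoothMetricOn G U) (hx : x ∈ U) (u v w : E) :
    fderiv ℝ G x u v w = fderiv ℝ G x u w v := by
  have hd := hG.differentiableAt hx
  rw [fderiv_eval hd, fderiv_eval (hd.clm_apply (differentiableAt_const v)),
    fderiv_eval hd, fderiv_eval (hd.clm_apply (differentiableAt_const w))]
  congr 1
  apply Filter.EventuallyEq.fderiv_eq
  filter_upwards [hG.isOpen.mem_nhds hx] with y hy using hG.symm y hy v w

theorem christoffel_symm (hG : IsSmoothMetricOn G U) (hx : x ∈ U) (u v : E) :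
    christoffel G x u v = christoffel G x v u :=
  RiemGeom.christoffel_symm (hG.fderiv_symm hx) u v

theorem fderiv_eq (hG : IsSmoothMetricOn G U) (hx : x ∈ U) (u v w : E) :
    fderiv ℝ G x u v w = G x (christoffel G x u v) w + G x v (christoffel G x u w) := by
  rw [christoffel_metric (hG.isInvertible x hx) (hG.fderiv_symm hx), hG.symm x hx v]

theorem injective (hG : IsSmoothMetricOn G U) (hx : x ∈ U) {u v : E}
    (h : ∀ w, G x u w = G x v w) : u = v :=
  (hG.isInvertible x hx).injective (ContinuousLinearMap.ext h)

variable [CompleteSpace E]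

theorem contDiffOn_christoffel (hG : IsSmoothMetricOn G U) :
    ContDiffOn ℝ ∞ (christoffel G) U := by
  have hD : ContDiffOn ℝ ∞ (fderiv ℝ G) U := hG.contDiffOn.contDiffOn_fderiv hG.isOpen
  have h1 : ContDiffOn ℝ ∞ (christoffelFirst G) U := by
    have hF : ContDiffOn ℝ ∞ (fun y ↦ (fderiv ℝ G y).flip) U :=
      (ContinuousLinearMap.flipₗᵢ ℝ E E (E →L[ℝ] ℝ)).contDiff.comp_contDiffOn hD
    exact ((hD.add hF).sub (contDiffOn_const.clm_comp hF)).const_smul (1 / 2 : ℝ)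
  have h2 : ContDiffOn ℝ ∞ (fun y ↦ (G y).inverse) U := fun y hy ↦
    (hG.isInvertible y hy).contDiffAt_map_inverse.comp_contDiffWithinAt y (hG.contDiffOn y hy)
  have h3 : ContDiffOn ℝ ∞
      (fun y ↦ ContinuousLinearMap.compL ℝ E (E →L[ℝ] ℝ) E (G y).inverse) U :=
    (ContinuousLinearMap.compL ℝ E (E →L[ℝ] ℝ) E).contDiff.comp_contDiffOn h2
  exact h3.clm_comp h1

theorem differentiableAt_christoffel (hG : IsSmoothMetricOn G U) (hx : x ∈ U) :
    DifferentiableAt ℝ (christoffel G) x :=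
  hG.contDiffOn_christoffel.differentiableAt_of_isOpen hG.isOpen hx

theorem contDiffOn_coordCurvature (hG : IsSmoothMetricOn G U) :
    ContDiffOn ℝ ∞ (coordCurvature G) U := by
  have hΓ := hG.contDiffOn_christoffel
  have hD := hΓ.contDiffOn_fderiv hG.isOpen
  have hQ : ContDiffOn ℝ ∞ (fun y ↦ (ContinuousLinearMap.compL ℝ E E E).bilinearComp
      (christoffel G y) (christoffel G y)) U := by
    have h1 : ContDiffOn ℝ ∞
        (fun y ↦ (ContinuousLinearMap.compL ℝ E E E).comp (christoffel G y)) U :=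
      contDiffOn_const.clm_comp hΓ
    have h2 := (ContinuousLinearMap.flipₗᵢ ℝ E (E →L[ℝ] E) (E →L[ℝ] E)).contDiff.comp_contDiffOn
      (n := ∞) h1
    exact (ContinuousLinearMap.flipₗᵢ ℝ E E (E →L[ℝ] E)).contDiff.comp_contDiffOn
      (h2.clm_comp hΓ)
  have f1 := (ContinuousLinearMap.flipₗᵢ ℝ E E (E →L[ℝ] E)).contDiff.comp_contDiffOn (n := ∞) hD
  have f2 := (ContinuousLinearMap.flipₗᵢ ℝ E E (E →L[ℝ] E)).contDiff.comp_contDiffOn (n := ∞) hQ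
  exact (hD.sub f1).add (hQ.sub f2)

theorem differentiableAt_coordCurvature (hG : IsSmoothMetricOn G U) (hx : x ∈ U) :
    DifferentiableAt ℝ (coordCurvature G) x :=
  hG.contDiffOn_coordCurvature.differentiableAt_of_isOpen hG.isOpen hx

end IsSmoothMetricOn

theorem coordCurvature_swap (G : E → E →L[ℝ] E →L[ℝ] ℝ) (x u v w : E) :
    coordCurvature G x u v w = -coordCurvature G x v u w := by
  simp only [coordCurvature_apply]
  abel

/-- The covariant derivative `(∇_w R)(u, v) z` of the curvature, for constant vector fields. -/
noncomputable def covDerivCurvature (G : E → E →L[ℝ] E →L[ℝ] ℝ) (x w u v z : E) : E :=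
  fderiv ℝ (coordCurvature G) x w u v z + christoffel G x w (coordCurvature G x u v z) -
    coordCurvature G x (christoffel G x w u) v z - coordCurvature G x u (christoffel G x w v) z -
    coordCurvature G x u v (christoffel G x w z)

namespace IsSmoothMetricOn

variable {G : E → E →L[ℝ] E →L[ℝ] ℝ} {U : Set E} {x : E} [CompleteSpace E]

theorem fderiv_christoffel_symm (hG : IsSmoothMetricOn G U) (hx : x ∈ U) (u v w : E) :
    fderiv ℝ (christoffel G) x u v w = fderiv ℝ (christoffel G) x u w v := by
  have hd := hG.differentiableAt_christoffel hx
  rw [fderiv_eval hd, fderiv_eval (hd.clm_apply (differentiableAt_const v)),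
    fderiv_eval hd, fderiv_eval (hd.clm_apply (differentiableAt_const w))]
  congr 1
  apply Filter.EventuallyEq.fderiv_eq
  filter_upwards [hG.isOpen.mem_nhds hx] with y hy using hG.christoffel_symm hy v w

/-- The first Bianchi identity. -/
theorem coordCurvature_bianchi (hG : IsSmoothMetricOn G U) (hx : x ∈ U) (u v w : E) :
    coordCurvature G x u v w + coordCurvature G x v w u + coordCurvature G x w u v = 0 := by
  simp only [coordCurvature_apply]
  rw [hG.fderiv_christoffel_symm hx u w v, hG.fderiv_christoffel_symm hx v w u,
    hG.fderiv_christoffel_symm hx w v u, hG.christoffel_symm hx w u,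
    hG.christoffel_symm hx w v, hG.christoffel_symm hx v u]
  abel

/-- The second derivative of the metric, by differentiating `∇G = 0`. -/
theorem fderiv_fderiv_eq (hG : IsSmoothMetricOn G U) (hx : x ∈ U) (u v w z : E) :
    fderiv ℝ (fderiv ℝ G) x u v w z =
      fderiv ℝ G x u (christoffel G x v w) z + G x (fderiv ℝ (christoffel G) x u v w) z +
      (fderiv ℝ G x u w (christoffel G x v z) +
        G x w (fderiv ℝ (christoffel G) x u v z)) := by
  have dG := hG.differentiableAt hx
  have dΓ := hG.differentiableAt_christoffel hx
  have dD : DifferentiableAt ℝ (fderiv ℝ G) x :=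
    (hG.contDiffOn.contDiffOn_fderiv hG.isOpen).differentiableAt_of_isOpen hG.isOpen hx
  have dv := dD.clm_apply (differentiableAt_const v)
  have dw := dv.clm_apply (differentiableAt_const w)
  rw [fderiv_eval dD, fderiv_eval dv, fderiv_eval dw]
  have e : (fun y ↦ fderiv ℝ G y v w z) =ᶠ[𝓝 x]
      fun y ↦ G y (christoffel G y v w) z + G y w (christoffel G y v z) := by
    filter_upwards [hG.isOpen.mem_nhds hx] with y hy using hG.fderiv_eq hy v w z
  have dΓ' : ∀ w, DifferentiableAt ℝ (fun y ↦ christoffel G y v w) x := fun w ↦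
    (dΓ.clm_apply (differentiableAt_const v)).clm_apply (differentiableAt_const w)
  have dΓ'' : ∀ w, fderiv ℝ (fun y ↦ christoffel G y v w) x u =
      fderiv ℝ (christoffel G) x u v w := fun w ↦ by
    rw [fderiv_eval dΓ, fderiv_eval (dΓ.clm_apply (differentiableAt_const v))]
  have d1 := dG.clm_apply (dΓ' w)
  have d2 := dG.clm_apply (differentiableAt_const w)
  rw [e.fderiv_eq, fderiv_fun_add (d1.clm_apply (differentiableAt_const z))
    (d2.clm_apply (dΓ' z)), add_apply, ← fderiv_eval d1,
    fderiv_clm_apply dG (dΓ' w), fderiv_clm_apply d2 (dΓ' z)]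
  simp only [add_apply, ContinuousLinearMap.comp_apply,
    ContinuousLinearMap.flip_apply, dΓ'', ← fderiv_eval dG]
  ring

/-- The connection is metric, so the curvature is skew-adjoint: alternate `fderiv_fderiv_eq` in
`u` and `v`, using the symmetry of the second derivative of `G`. -/
theorem coordCurvature_skew (hG : IsSmoothMetricOn G U) (hx : x ∈ U) (u v w z : E) :
    G x (coordCurvature G x u v w) z = -G x (coordCurvature G x u v z) w := by
  have h := hG.contDiffOn.fderiv_fderiv_comm hG.isOpen hx u v
  have h' := DFunLike.congr_fun (DFunLike.congr_fun h w) z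
  rw [hG.fderiv_fderiv_eq hx, hG.fderiv_fderiv_eq hx, hG.fderiv_eq hx, hG.fderiv_eq hx,
    hG.fderiv_eq hx, hG.fderiv_eq hx] at h'
  simp only [coordCurvature_apply, map_add, map_sub, add_apply,
    sub_apply]
  have s := hG.symm x hx
  rw [s _ w, s _ w, s _ w, s _ w]
  linarith

theorem fderiv_coordCurvature (hG : IsSmoothMetricOn G U) (hx : x ∈ U) (w u v z : E) :
    fderiv ℝ (coordCurvature G) x w u v z =
      fderiv ℝ (fderiv ℝ (christoffel G)) x w u v z -
        fderiv ℝ (fderiv ℝ (christoffel G)) x w v u z +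
      (fderiv ℝ (christoffel G) x w u (christoffel G x v z) +
        christoffel G x u (fderiv ℝ (christoffel G) x w v z) -
      (fderiv ℝ (christoffel G) x w v (christoffel G x u z) +
        christoffel G x v (fderiv ℝ (christoffel G) x w u z))) := by
  have dF := hG.differentiableAt_coordCurvature hx
  have dΓ := hG.differentiableAt_christoffel hx
  have dD : DifferentiableAt ℝ (fderiv ℝ (christoffel G)) x :=
    (hG.contDiffOn_christoffel.contDiffOn_fderiv hG.isOpen).differentiableAt_of_isOpen hG.isOpen hx
  have c1 : ∀ u, DifferentiableAt ℝ (fun y ↦ christoffel G y u) x := fun u ↦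
    dΓ.clm_apply (differentiableAt_const u)
  have c2 : ∀ u z, DifferentiableAt ℝ (fun y ↦ christoffel G y u z) x := fun u z ↦
    (c1 u).clm_apply (differentiableAt_const z)
  have c3 : ∀ u v z, DifferentiableAt ℝ (fun y ↦ christoffel G y u (christoffel G y v z)) x :=
    fun u v z ↦ (c1 u).clm_apply (c2 v z)
  have D1 : ∀ u, DifferentiableAt ℝ (fun y ↦ fderiv ℝ (christoffel G) y u) x := fun u ↦
    dD.clm_apply (differentiableAt_const u)
  have D2 : ∀ u v, DifferentiableAt ℝ (fun y ↦ fderiv ℝ (christoffel G) y u v) x := fun u v ↦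
    (D1 u).clm_apply (differentiableAt_const v)
  have D3 : ∀ u v z, DifferentiableAt ℝ (fun y ↦ fderiv ℝ (christoffel G) y u v z) x :=
    fun u v z ↦ (D2 u v).clm_apply (differentiableAt_const z)
  have f1 := dF.clm_apply (differentiableAt_const u)
  rw [fderiv_eval dF, fderiv_eval f1, fderiv_eval (f1.clm_apply (differentiableAt_const v))]
  simp only [coordCurvature_apply]
  rw [fderiv_fun_add ((D3 u v z).fun_sub (D3 v u z)) ((c3 u v z).fun_sub (c3 v u z)),
    fderiv_fun_sub (D3 u v z) (D3 v u z), fderiv_fun_sub (c3 u v z) (c3 v u z),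
    fderiv_clm_apply (c1 u) (c2 v z), fderiv_clm_apply (c1 v) (c2 u z)]
  simp only [add_apply, sub_apply,
    ContinuousLinearMap.comp_apply, ContinuousLinearMap.flip_apply, ← fderiv_eval dΓ,
    ← fderiv_eval (c1 _), ← fderiv_eval (D2 _ _), ← fderiv_eval (D1 _), ← fderiv_eval dD]
  abel

/-- The second Bianchi identity. -/
theorem covDerivCurvature_bianchi (hG : IsSmoothMetricOn G U) (hx : x ∈ U) (w u v z : E) :
    covDerivCurvature G x w u v z + covDerivCurvature G x u v w z +
      covDerivCurvature G x v w u z = 0 := by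
  have hc := hG.contDiffOn_christoffel.fderiv_fderiv_comm hG.isOpen hx
  simp only [covDerivCurvature, hG.fderiv_coordCurvature hx]
  -- the terms with a Christoffel symbol in the first two arguments of the curvature cancel in
  -- pairs, as the connection is torsion-free
  rw [coordCurvature_swap G x u (christoffel G x w v), coordCurvature_swap G x v
    (christoffel G x u w), coordCurvature_swap G x w (christoffel G x v u),
    hG.christoffel_symm hx w v, hG.christoffel_symm hx u w, hG.christoffel_symm hx v u]
  generalize coordCurvature G x (christoffel G x w u) v z = a
  generalize coordCurvature G x (christoffel G x v w) u z = b
  generalize coordCurvature G x (christoffel G x u v) w z = c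
  rw [hc u w, hc v w, hc v u]
  simp only [coordCurvature_apply, map_add, map_sub]
  abel

end IsSmoothMetricOn

end CoordinateMetric

/-! ### Schur's lemma in coordinates -/

section CoordinateSchur

variable {E : Type*} [NormedAddCommGroup E] [NormedSpace ℝ E]

/-- The Ricci tensor in coordinates, the trace of `X ↦ R(X, v) z`. -/
noncomputable def coordRicci (G : E → E →L[ℝ] E →L[ℝ] ℝ) (x v z : E) : ℝ :=
  LinearMap.trace ℝ E (((coordCurvature G x).flip v).flip z : E →L[ℝ] E)

theorem repr_eq_of_orthonormal {ι : Type*} [Fintype ι] [DecidableEq ι]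
    (B : E →L[ℝ] E →L[ℝ] ℝ) (b : Module.Basis ι ℝ E)
    (hb : ∀ i j, B (b i) (b j) = if i = j then 1 else 0) (v : E) (i : ι) :
    b.repr v i = B v (b i) := by
  have h := congrArg (fun u ↦ B u (b i)) (b.sum_repr v)
  simpa only [map_sum, map_smul, sum_apply, smul_apply, hb, smul_eq_mul, mul_ite, mul_one,
    mul_zero, Finset.sum_ite_eq', Finset.mem_univ, if_true] using h

theorem trace_eq_sum_of_orthonormal {ι : Type*} [Fintype ι] [DecidableEq ι]
    (B : E →L[ℝ] E →L[ℝ] ℝ) (b : Module.Basis ι ℝ E)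
    (hb : ∀ i j, B (b i) (b j) = if i = j then 1 else 0) (f : E →ₗ[ℝ] E) :
    LinearMap.trace ℝ E f = ∑ i, B (f (b i)) (b i) := by
  rw [LinearMap.trace_eq_matrix_trace ℝ b, Matrix.trace]
  refine Finset.sum_congr rfl fun i _ ↦ ?_
  rw [Matrix.diag_apply, LinearMap.toMatrix_apply, repr_eq_of_orthonormal B b hb]

theorem sum_mul_apply_of_orthonormal {ι : Type*} [Fintype ι] [DecidableEq ι]
    (B : E →L[ℝ] E →L[ℝ] ℝ) (b : Module.Basis ι ℝ E)
    (hb : ∀ i j, B (b i) (b j) = if i = j then 1 else 0) (l : E →L[ℝ] ℝ) (w : E) :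
    ∑ i, l (b i) * B w (b i) = l w := by
  conv_rhs => rw [← b.sum_repr w, map_sum]
  refine Finset.sum_congr rfl fun i _ ↦ ?_
  rw [map_smul, repr_eq_of_orthonormal B b hb, smul_eq_mul, mul_comm]

theorem sum_coordCurvature {ι : Type*} [Fintype ι] [DecidableEq ι]
    (G : E → E →L[ℝ] E →L[ℝ] ℝ) (B : E →L[ℝ] E →L[ℝ] ℝ) (b : Module.Basis ι ℝ E)
    (hb : ∀ i j, B (b i) (b j) = if i = j then 1 else 0) (y v z : E) :
    ∑ i, B (coordCurvature G y (b i) v z) (b i) = coordRicci G y v z :=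
  (trace_eq_sum_of_orthonormal B b hb (((coordCurvature G y).flip v).flip z : E →L[ℝ] E)).symm

/-- A Christoffel term may be moved around the contraction, as `tr (AB) = tr (BA)`. -/
theorem sum_christoffel_coordCurvature {ι : Type*} [Fintype ι] [DecidableEq ι]
    (G : E → E →L[ℝ] E →L[ℝ] ℝ) (B : E →L[ℝ] E →L[ℝ] ℝ) (b : Module.Basis ι ℝ E)
    (hb : ∀ i j, B (b i) (b j) = if i = j then 1 else 0) (x w v z : E) :
    ∑ i, B (christoffel G x w (coordCurvature G x (b i) v z)) (b i) =
      ∑ i, B (coordCurvature G x (christoffel G x w (b i)) v z) (b i) := by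
  let A : E →ₗ[ℝ] E := (((coordCurvature G x).flip v).flip z : E →L[ℝ] E)
  let C : E →ₗ[ℝ] E := (christoffel G x w : E →L[ℝ] E)
  have t := LinearMap.trace_mul_comm ℝ C A
  rw [trace_eq_sum_of_orthonormal B b hb, trace_eq_sum_of_orthonormal B b hb] at t
  exact t

namespace IsSmoothMetricOn

variable {G : E → E →L[ℝ] E →L[ℝ] ℝ} {U : Set E} {x : E} [CompleteSpace E]

theorem covDerivCurvature_skew (hG : IsSmoothMetricOn G U) (hx : x ∈ U) (w u v z z' : E) :
    G x (covDerivCurvature G x w u v z) z' = -G x (covDerivCurvature G x w u v z') z := by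
  have dG := hG.differentiableAt hx
  have dF := hG.differentiableAt_coordCurvature hx
  have d1 := dF.clm_apply (differentiableAt_const u)
  have d2 := d1.clm_apply (differentiableAt_const v)
  have d3 : ∀ z, DifferentiableAt ℝ (fun y ↦ coordCurvature G y u v z) x := fun z ↦
    d2.clm_apply (differentiableAt_const z)
  have key : ∀ z z', fderiv ℝ (fun y ↦ G y (coordCurvature G y u v z) z') x w =
      fderiv ℝ G x w (coordCurvature G x u v z) z' +
        G x (fderiv ℝ (coordCurvature G) x w u v z) z' := by
    intro z z'
    have d4 := dG.clm_apply (d3 z)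
    rw [← fderiv_eval d4, fderiv_clm_apply dG (d3 z), fderiv_eval dF, fderiv_eval d1,
      fderiv_eval d2]
    simp [add_comm]
  have e : (fun y ↦ G y (coordCurvature G y u v z) z') =ᶠ[𝓝 x]
      fun y ↦ -G y (coordCurvature G y u v z') z := by
    filter_upwards [hG.isOpen.mem_nhds hx] with y hy using hG.coordCurvature_skew hy u v z z'
  have h := congrArg (fun L : E →L[ℝ] ℝ ↦ L w) e.fderiv_eq
  simp only [fderiv_fun_neg, neg_apply, key] at h
  rw [hG.fderiv_eq hx, hG.fderiv_eq hx] at h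
  simp only [covDerivCurvature, map_add, map_sub, add_apply, sub_apply]
  have h1 := hG.coordCurvature_skew hx (christoffel G x w u) v z z'
  have h2 := hG.coordCurvature_skew hx u (christoffel G x w v) z z'
  have h3 := hG.coordCurvature_skew hx u v (christoffel G x w z) z'
  have h4 := hG.coordCurvature_skew hx u v (christoffel G x w z') z
  linarith

theorem covDerivCurvature_swap (hG : IsSmoothMetricOn G U) (hx : x ∈ U) (w u v z : E) :
    covDerivCurvature G x w u v z = -covDerivCurvature G x w v u z := by
  have dF := hG.differentiableAt_coordCurvature hx
  have : fderiv ℝ (coordCurvature G) x w u v z = -fderiv ℝ (coordCurvature G) x w v u z := by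
    simp only [hG.fderiv_coordCurvature hx]
    abel
  simp only [covDerivCurvature]
  rw [this, coordCurvature_swap G x u v, coordCurvature_swap G x u v,
    coordCurvature_swap G x (christoffel G x w u), coordCurvature_swap G x u, map_neg]
  abel

theorem sum_fderiv_coordCurvature (hG : IsSmoothMetricOn G U) (hx : x ∈ U) {l : E → ℝ}
    (hl : DifferentiableAt ℝ l x) (hric : ∀ y ∈ U, ∀ v z, coordRicci G y v z = l y * G y v z)
    {ι : Type*} [Fintype ι] [DecidableEq ι] (b : Module.Basis ι ℝ E)
    (hb : ∀ i j, G x (b i) (b j) = if i = j then 1 else 0) (w v z : E) :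
    ∑ i, G x (fderiv ℝ (coordCurvature G) x w (b i) v z) (b i) =
      fderiv ℝ l x w * G x v z + l x * fderiv ℝ G x w v z := by
  have dG := hG.differentiableAt hx
  have dF := hG.differentiableAt_coordCurvature hx
  have d1 : ∀ u, DifferentiableAt ℝ (fun y ↦ coordCurvature G y u) x := fun u ↦
    dF.clm_apply (differentiableAt_const u)
  have d2 : ∀ u, DifferentiableAt ℝ (fun y ↦ coordCurvature G y u v) x := fun u ↦
    (d1 u).clm_apply (differentiableAt_const v)
  have d3 : ∀ u, DifferentiableAt ℝ (fun y ↦ coordCurvature G y u v z) x := fun u ↦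
    (d2 u).clm_apply (differentiableAt_const z)
  have dGv := dG.clm_apply (differentiableAt_const v)
  have e1 : ∀ u, HasFDerivAt (fun y ↦ G x (coordCurvature G y u v z) u)
      (((G x).flip u).comp (fderiv ℝ (fun y ↦ coordCurvature G y u v z) x)) x := fun u ↦
    ((G x).flip u).hasFDerivAt.comp x (d3 u).hasFDerivAt
  have e2 : HasFDerivAt (fun y ↦ ∑ i, G x (coordCurvature G y (b i) v z) (b i))
      (∑ i, ((G x).flip (b i)).comp (fderiv ℝ (fun y ↦ coordCurvature G y (b i) v z) x)) x :=
    HasFDerivAt.fun_sum fun i _ ↦ e1 (b i)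
  have e3 : (fun y ↦ ∑ i, G x (coordCurvature G y (b i) v z) (b i)) =ᶠ[𝓝 x]
      fun y ↦ l y * G y v z := by
    filter_upwards [hG.isOpen.mem_nhds hx] with y hy
    rw [sum_coordCurvature G (G x) b hb, hric y hy]
  have e4 := congrArg (fun L : E →L[ℝ] ℝ ↦ L w) (e2.fderiv.symm.trans e3.fderiv_eq)
  rw [fderiv_fun_mul hl (dGv.clm_apply (differentiableAt_const z))] at e4
  simp only [sum_apply, add_apply, smul_apply, smul_eq_mul, ContinuousLinearMap.comp_apply,
    ContinuousLinearMap.flip_apply, ← fderiv_eval (d2 _), ← fderiv_eval (d1 _),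
    ← fderiv_eval dF, ← fderiv_eval dGv, ← fderiv_eval dG] at e4
  rw [e4]
  ring

/-- If `Ric = l G`, then the contraction of `∇_w R` is `(dl)(w) G`. -/
theorem sum_covDerivCurvature (hG : IsSmoothMetricOn G U) (hx : x ∈ U) {l : E → ℝ}
    (hl : DifferentiableAt ℝ l x) (hric : ∀ y ∈ U, ∀ v z, coordRicci G y v z = l y * G y v z)
    {ι : Type*} [Fintype ι] [DecidableEq ι] (b : Module.Basis ι ℝ E)
    (hb : ∀ i j, G x (b i) (b j) = if i = j then 1 else 0) (w v z : E) :
    ∑ i, G x (covDerivCurvature G x w (b i) v z) (b i) = fderiv ℝ l x w * G x v z := by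
  simp only [covDerivCurvature, map_add, map_sub, add_apply, sub_apply,
    Finset.sum_add_distrib, Finset.sum_sub_distrib,
    hG.sum_fderiv_coordCurvature hx hl hric b hb, sum_christoffel_coordCurvature G (G x) b hb,
    sum_coordCurvature G (G x) b hb, hric x hx, hG.fderiv_eq hx]
  ring

/-- **Schur's lemma** in coordinates: contract the second Bianchi identity twice. -/
theorem fderiv_eq_zero_of_ricci_eq (hG : IsSmoothMetricOn G U) (hx : x ∈ U) {l : E → ℝ}
    (hl : DifferentiableAt ℝ l x) (hric : ∀ y ∈ U, ∀ v z, coordRicci G y v z = l y * G y v z)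
    {ι : Type*} [Fintype ι] [DecidableEq ι] (b : Module.Basis ι ℝ E)
    (hb : ∀ i j, G x (b i) (b j) = if i = j then 1 else 0) (hι : Fintype.card ι ≠ 2) :
    fderiv ℝ l x = 0 := by
  ext w
  have hS := hG.sum_covDerivCurvature hx hl hric b hb
  have hsum : ∑ j, ∑ i, (G x (covDerivCurvature G x w (b i) (b j) (b j)) (b i) +
      G x (covDerivCurvature G x (b i) (b j) w (b j)) (b i) +
      G x (covDerivCurvature G x (b j) w (b i) (b j)) (b i)) = 0 := by
    refine Finset.sum_eq_zero fun j _ ↦ Finset.sum_eq_zero fun i _ ↦ ?_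
    rw [← add_apply, ← add_apply, ← map_add, ← map_add, hG.covDerivCurvature_bianchi hx]
    simp
  simp only [Finset.sum_add_distrib] at hsum
  have s1 : ∑ j, ∑ i, G x (covDerivCurvature G x w (b i) (b j) (b j)) (b i) =
      Fintype.card ι * fderiv ℝ l x w := by
    simp [hS, hb]
  have s2 : ∑ j, ∑ i, G x (covDerivCurvature G x (b i) (b j) w (b j)) (b i) =
      -fderiv ℝ l x w := by
    rw [Finset.sum_comm]
    rw [← sum_mul_apply_of_orthonormal (G x) b hb, ← Finset.sum_neg_distrib]
    refine Finset.sum_congr rfl fun i _ ↦ ?_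
    rw [← hS, ← Finset.sum_neg_distrib]
    exact Finset.sum_congr rfl fun j _ ↦ hG.covDerivCurvature_skew hx _ _ _ _ _
  have s3 : ∑ j, ∑ i, G x (covDerivCurvature G x (b j) w (b i) (b j)) (b i) =
      -fderiv ℝ l x w := by
    simp only [hG.covDerivCurvature_swap hx _ w, map_neg, neg_apply, Finset.sum_neg_distrib,
      hS, sum_mul_apply_of_orthonormal (G x) b hb]
  rw [s1, s2, s3] at hsum
  have : ((Fintype.card ι : ℝ) - 2) * fderiv ℝ l x w = 0 := by linarith
  rcases mul_eq_zero.1 this with h | h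
  · exact absurd (by exact_mod_cast sub_eq_zero.1 h) hι
  · simpa using h

end IsSmoothMetricOn

end CoordinateSchur

/-! ### Naturality of the curvature -/

section Covariance

variable {E : Type*} [NormedAddCommGroup E] [NormedSpace ℝ E]

/-- `φ` is a smooth map on `U` with surjective differentials that pulls the metric `G` back
to `G'`. -/
structure IsPullbackMetric (G' G : E → E →L[ℝ] E →L[ℝ] ℝ) (φ : E → E) (U V : Set E) : Prop where
  source : IsSmoothMetricOn G' U
  target : IsSmoothMetricOn G V
  contDiffOn : ContDiffOn ℝ ∞ φ U
  mapsTo : Set.MapsTo φ U V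
  surjective : ∀ x ∈ U, Function.Surjective (fderiv ℝ φ x)
  apply_eq : ∀ x ∈ U, ∀ u v, G' x u v = G (φ x) (fderiv ℝ φ x u) (fderiv ℝ φ x v)

namespace IsPullbackMetric

variable {G' G : E → E →L[ℝ] E →L[ℝ] ℝ} {φ : E → E} {U V : Set E} {x : E}

theorem fderiv_metric (h : IsPullbackMetric G' G φ U V) (hx : x ∈ U) (u v w : E) :
    fderiv ℝ G' x u v w =
      fderiv ℝ G (φ x) (fderiv ℝ φ x u) (fderiv ℝ φ x v) (fderiv ℝ φ x w) +
      G (φ x) (fderiv ℝ (fderiv ℝ φ) x u v) (fderiv ℝ φ x w) +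
      G (φ x) (fderiv ℝ φ x v) (fderiv ℝ (fderiv ℝ φ) x u w) := by
  have hU := h.source.isOpen
  have dG' := h.source.differentiableAt hx
  have dG := h.target.differentiableAt (h.mapsTo hx)
  have dφ := h.contDiffOn.differentiableAt_of_isOpen hU hx
  have dA := (h.contDiffOn.contDiffOn_fderiv hU).differentiableAt_of_isOpen hU hx
  have dAv : ∀ v, DifferentiableAt ℝ (fun y ↦ fderiv ℝ φ y v) x := fun v ↦
    dA.clm_apply (differentiableAt_const v)
  have dGφ : HasFDerivAt (fun y ↦ G (φ y)) ((fderiv ℝ G (φ x)).comp (fderiv ℝ φ x)) x :=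
    dG.hasFDerivAt.comp x dφ.hasFDerivAt
  rw [fderiv_eval dG', fderiv_eval (dG'.clm_apply (differentiableAt_const v))]
  have e : (fun y ↦ G' y v w) =ᶠ[𝓝 x] fun y ↦ G (φ y) (fderiv ℝ φ y v) (fderiv ℝ φ y w) := by
    filter_upwards [hU.mem_nhds hx] with y hy using h.apply_eq y hy v w
  have d1 := dGφ.differentiableAt.clm_apply (dAv v)
  rw [e.fderiv_eq, fderiv_clm_apply d1 (dAv w), fderiv_clm_apply dGφ.differentiableAt (dAv v),
    dGφ.fderiv]
  simp only [add_apply, ContinuousLinearMap.comp_apply, ContinuousLinearMap.flip_apply,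
    ← fderiv_eval dA]
  ring

/-- The transformation law of the Christoffel symbols. -/
theorem apply_christoffel (h : IsPullbackMetric G' G φ U V) (hx : x ∈ U) (u v : E) :
    fderiv ℝ φ x (christoffel G' x u v) =
      fderiv ℝ (fderiv ℝ φ) x u v +
        christoffel G (φ x) (fderiv ℝ φ x u) (fderiv ℝ φ x v) := by
  have hc := h.contDiffOn.fderiv_fderiv_comm h.source.isOpen hx
  have s := h.target.symm _ (h.mapsTo hx)
  refine h.target.injective (h.mapsTo hx) fun z ↦ ?_
  obtain ⟨w, rfl⟩ := h.surjective x hx z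
  rw [← h.apply_eq x hx, RiemGeom.apply_christoffel (h.source.isInvertible x hx), map_add,
    add_apply, RiemGeom.apply_christoffel (h.target.isInvertible _ (h.mapsTo hx)),
    christoffelFirst_apply, christoffelFirst_apply, h.fderiv_metric hx, h.fderiv_metric hx,
    h.fderiv_metric hx, hc v u, hc w u, hc w v, s (fderiv ℝ φ x v), s (fderiv ℝ φ x u) (_)]
  ring

variable [CompleteSpace E]

/-- The derivative of the transformation law of the Christoffel symbols. -/
theorem apply_fderiv_christoffel (h : IsPullbackMetric G' G φ U V) (hx : x ∈ U) (u v w : E) :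
    fderiv ℝ φ x (fderiv ℝ (christoffel G') x u v w) +
        fderiv ℝ (fderiv ℝ φ) x u (christoffel G' x v w) =
      fderiv ℝ (fderiv ℝ (fderiv ℝ φ)) x u v w +
        (fderiv ℝ (christoffel G) (φ x) (fderiv ℝ φ x u) (fderiv ℝ φ x v) (fderiv ℝ φ x w) +
        christoffel G (φ x) (fderiv ℝ (fderiv ℝ φ) x u v) (fderiv ℝ φ x w) +
        christoffel G (φ x) (fderiv ℝ φ x v) (fderiv ℝ (fderiv ℝ φ) x u w)) := by
  have hU := h.source.isOpen
  have dΓ' := h.source.differentiableAt_christoffel hx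
  have dΓ := h.target.differentiableAt_christoffel (h.mapsTo hx)
  have dφ := h.contDiffOn.differentiableAt_of_isOpen hU hx
  have cA := h.contDiffOn.contDiffOn_fderiv hU
  have dA := cA.differentiableAt_of_isOpen hU hx
  have dB := (cA.contDiffOn_fderiv hU).differentiableAt_of_isOpen hU hx
  have dAv : ∀ v, DifferentiableAt ℝ (fun y ↦ fderiv ℝ φ y v) x := fun v ↦
    dA.clm_apply (differentiableAt_const v)
  have dBv := dB.clm_apply (differentiableAt_const v)
  have dΓφ : HasFDerivAt (fun y ↦ christoffel G (φ y))
      ((fderiv ℝ (christoffel G) (φ x)).comp (fderiv ℝ φ x)) x :=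
    dΓ.hasFDerivAt.comp x dφ.hasFDerivAt
  have d1 := dΓφ.differentiableAt.clm_apply (dAv v)
  have d2 := dΓ'.clm_apply (differentiableAt_const v)
  have d3 := d2.clm_apply (differentiableAt_const w)
  have e : (fun y ↦ fderiv ℝ φ y (christoffel G' y v w)) =ᶠ[𝓝 x] fun y ↦
      fderiv ℝ (fderiv ℝ φ) y v w + christoffel G (φ y) (fderiv ℝ φ y v) (fderiv ℝ φ y w) := by
    filter_upwards [hU.mem_nhds hx] with y hy using h.apply_christoffel hy v w
  have key := congrArg (fun L : E →L[ℝ] E ↦ L u) e.fderiv_eq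
  rw [fderiv_clm_apply dA d3, fderiv_fun_add (dBv.clm_apply (differentiableAt_const w))
    (d1.clm_apply (dAv w)), fderiv_clm_apply d1 (dAv w),
    fderiv_clm_apply dΓφ.differentiableAt (dAv v), dΓφ.fderiv] at key
  simp only [add_apply, ContinuousLinearMap.comp_apply, ContinuousLinearMap.flip_apply,
    ← fderiv_eval dA, ← fderiv_eval d2, ← fderiv_eval dΓ', ← fderiv_eval dBv,
    ← fderiv_eval dB] at key
  rw [key]
  abel

/-- The curvature is natural under pullback. -/
theorem apply_coordCurvature (h : IsPullbackMetric G' G φ U V) (hx : x ∈ U) (u v w : E) :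
    fderiv ℝ φ x (coordCurvature G' x u v w) =
      coordCurvature G (φ x) (fderiv ℝ φ x u) (fderiv ℝ φ x v) (fderiv ℝ φ x w) := by
  have hU := h.source.isOpen
  have cA := h.contDiffOn.contDiffOn_fderiv hU
  have h3 := cA.fderiv_fderiv_comm hU hx u v
  have h2 := h.contDiffOn.fderiv_fderiv_comm hU hx u v
  have k1 := eq_sub_of_add_eq (h.apply_fderiv_christoffel hx u v w)
  have k2 := eq_sub_of_add_eq (h.apply_fderiv_christoffel hx v u w)
  simp only [coordCurvature_apply, map_add, map_sub, k1, k2, h.apply_christoffel hx, h3, h2]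
  abel

end IsPullbackMetric

end Covariance

/-! ### The metric and the curvature in the preferred charts -/

section Charts

variable {E : Type*} [NormedAddCommGroup E] [NormedSpace ℝ E]
  {M : Type*} [TopologicalSpace M] [ChartedSpace E M]

/-- The differential at `q` of the preferred chart around `p`. -/
noncomputable def chartDerivAt (p q : M) : TangentSpace 𝓘(ℝ, E) q →L[ℝ] E :=
  mfderiv 𝓘(ℝ, E) 𝓘(ℝ, E) (extChartAt 𝓘(ℝ, E) p) q

/-- The change of coordinates from the preferred chart around `q` to that around `p`. -/
noncomputable def chartTransition (E : Type*) [NormedAddCommGroup E] [NormedSpace ℝ E]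
    {M : Type*} [TopologicalSpace M] [ChartedSpace E M] (p q : M) : E → E :=
  extChartAt 𝓘(ℝ, E) p ∘ (extChartAt 𝓘(ℝ, E) q).symm

/-- The part of the preferred chart around `q` that lies in the preferred chart around `p`. -/
def chartOverlap (E : Type*) [NormedAddCommGroup E] [NormedSpace ℝ E]
    {M : Type*} [TopologicalSpace M] [ChartedSpace E M] (p q : M) : Set E :=
  (extChartAt 𝓘(ℝ, E) q).target ∩
    (extChartAt 𝓘(ℝ, E) q).symm ⁻¹' (extChartAt 𝓘(ℝ, E) p).source

theorem isOpen_chartOverlap (p q : M) : IsOpen (chartOverlap E p q) :=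
  (continuousOn_extChartAt_symm q).isOpen_inter_preimage (isOpen_extChartAt_target q)
    (isOpen_extChartAt_source p)

/-- The inner product only depends on the base point and on the vectors of the model space `E`. -/
theorem inner_tangentSpace_congr [Bundle.RiemannianBundle (fun x : M ↦ TangentSpace 𝓘(ℝ, E) x)]
    {a b : M} (h : a = b) (u v u' v' : E) (hu : u = u') (hv : v = v') :
    @inner ℝ (TangentSpace 𝓘(ℝ, E) a) _ u v = @inner ℝ (TangentSpace 𝓘(ℝ, E) b) _ u' v' := by
  subst h hu hv
  rfl

variable [IsManifold 𝓘(ℝ, E) ∞ M]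

theorem isInvertible_chartDerivAt {p q : M} (hq : q ∈ (extChartAt 𝓘(ℝ, E) p).source) :
    (chartDerivAt (E := E) p q).IsInvertible := by
  have : IsManifold 𝓘(ℝ, E) 1 M := .of_le (n := ∞) (by simp)
  exact isInvertible_mfderiv_extChartAt hq

theorem chartDerivAt_chartSymmDeriv {p : M} {y : E} (hy : y ∈ (extChartAt 𝓘(ℝ, E) p).target)
    (v : E) : chartDerivAt p ((extChartAt 𝓘(ℝ, E) p).symm y) (chartSymmDeriv p y v) = v := by
  have : IsManifold 𝓘(ℝ, E) 1 M := .of_le (n := ∞) (by simp)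
  have h := mfderiv_extChartAt_comp_mfderivWithin_extChartAt_symm (I := 𝓘(ℝ, E)) hy
  rw [modelWithCornersSelf_coe, Set.range_id, mfderivWithin_univ] at h
  exact DFunLike.congr_fun h v

theorem chartSymmDeriv_chartDerivAt {p : M} {y : E} (hy : y ∈ (extChartAt 𝓘(ℝ, E) p).target)
    (v : TangentSpace 𝓘(ℝ, E) ((extChartAt 𝓘(ℝ, E) p).symm y)) :
    chartSymmDeriv p y (chartDerivAt p ((extChartAt 𝓘(ℝ, E) p).symm y) v) = v := by
  have : IsManifold 𝓘(ℝ, E) 1 M := .of_le (n := ∞) (by simp)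
  have h := mfderivWithin_extChartAt_symm_comp_mfderiv_extChartAt (I := 𝓘(ℝ, E)) hy
  rw [modelWithCornersSelf_coe, Set.range_id, mfderivWithin_univ] at h
  exact DFunLike.congr_fun h v

theorem contDiffOn_chartTransition (p q : M) :
    ContDiffOn ℝ ∞ (chartTransition E p q) (chartOverlap E p q) := by
  rw [← contMDiffOn_iff_contDiffOn]
  exact (contMDiffOn_extChartAt (I := 𝓘(ℝ, E)) (x := p)).comp
    ((contMDiffOn_extChartAt_symm q).mono Set.inter_subset_left) fun y hy ↦ by
      simpa using hy.2

theorem mdifferentiableAt_extChartAt_symm_of_mem {p : M} {y : E}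
    (hy : y ∈ (extChartAt 𝓘(ℝ, E) p).target) :
    MDifferentiableAt 𝓘(ℝ, E) 𝓘(ℝ, E) (extChartAt 𝓘(ℝ, E) p).symm y :=
  ((contMDiffOn_extChartAt_symm (n := ∞) p).contMDiffAt
    ((isOpen_extChartAt_target p).mem_nhds hy)).mdifferentiableAt (by simp)

theorem mdifferentiableAt_extChartAt_of_mem {p q : M}
    (hq : q ∈ (extChartAt 𝓘(ℝ, E) p).source) :
    MDifferentiableAt 𝓘(ℝ, E) 𝓘(ℝ, E) (extChartAt 𝓘(ℝ, E) p) q :=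
  (contMDiffAt_extChartAt' (n := ∞) (by simpa using hq)).mdifferentiableAt (by simp)

theorem fderiv_chartTransition {p q : M} {y : E} (hy : y ∈ chartOverlap E p q) (v : E) :
    fderiv ℝ (chartTransition E p q) y v =
      chartDerivAt p ((extChartAt 𝓘(ℝ, E) q).symm y) (chartSymmDeriv q y v) := by
  rw [← mfderiv_eq_fderiv, chartTransition, mfderiv_comp (I' := 𝓘(ℝ, E)) y
    (mdifferentiableAt_extChartAt_of_mem hy.2) (mdifferentiableAt_extChartAt_symm_of_mem hy.1)]
  rfl

theorem fderiv_chartTransition_chartDeriv {p q : M} (hq : q ∈ (extChartAt 𝓘(ℝ, E) p).source)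
    (X : TangentSpace 𝓘(ℝ, E) q) :
    fderiv ℝ (chartTransition E p q) (extChartAt 𝓘(ℝ, E) q q) (chartDeriv q X) =
      chartDerivAt p q X := by
  have hqq := mem_extChartAt_source (I := 𝓘(ℝ, E)) q
  have hqt := mem_extChartAt_target (I := 𝓘(ℝ, E)) q
  have hy : extChartAt 𝓘(ℝ, E) q q ∈ chartOverlap E p q :=
    ⟨hqt, by simpa using hq⟩
  have hd : DifferentiableAt ℝ (chartTransition E p q) (extChartAt 𝓘(ℝ, E) q q) :=
    (contDiffOn_chartTransition p q).differentiableAt_of_isOpen (isOpen_chartOverlap p q) hy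
  have e : extChartAt 𝓘(ℝ, E) p =ᶠ[𝓝 q] chartTransition E p q ∘ extChartAt 𝓘(ℝ, E) q := by
    filter_upwards [(isOpen_extChartAt_source (I := 𝓘(ℝ, E)) q).mem_nhds hqq] with z hz
    change _ = extChartAt 𝓘(ℝ, E) p ((extChartAt 𝓘(ℝ, E) q).symm (extChartAt 𝓘(ℝ, E) q z))
    rw [(extChartAt 𝓘(ℝ, E) q).left_inv hz]
  have h := e.mfderiv_eq (I := 𝓘(ℝ, E)) (I' := 𝓘(ℝ, E))
  rw [mfderiv_comp (I' := 𝓘(ℝ, E)) q hd.mdifferentiableAt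
    (mdifferentiableAt_extChartAt_of_mem hqq), mfderiv_eq_fderiv] at h
  exact (DFunLike.congr_fun h X).symm

/-- The chain rule for the inverse charts around `q` and `p`, which near `y` differ by the change
of coordinates. The tangent spaces of the two sides have equal, but not syntactically equal, base
points; the equation is one between vectors of the model space `E`. -/
theorem chartSymmDeriv_eq {p q : M} {y : E} (hy : y ∈ chartOverlap E p q) (v : E) :
    (chartSymmDeriv q y v : E) =
      chartSymmDeriv p (chartTransition E p q y) (fderiv ℝ (chartTransition E p q) y v) := by
  have e : (extChartAt 𝓘(ℝ, E) q).symm =ᶠ[𝓝 y]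
      (extChartAt 𝓘(ℝ, E) p).symm ∘ chartTransition E p q := by
    filter_upwards [(isOpen_chartOverlap p q).mem_nhds hy] with z hz
    exact ((extChartAt 𝓘(ℝ, E) p).left_inv hz.2).symm
  have hd : DifferentiableAt ℝ (chartTransition E p q) y :=
    (contDiffOn_chartTransition p q).differentiableAt_of_isOpen (isOpen_chartOverlap p q) hy
  have h := e.mfderiv_eq (I := 𝓘(ℝ, E)) (I' := 𝓘(ℝ, E))
  rw [mfderiv_comp (I' := 𝓘(ℝ, E)) y (mdifferentiableAt_extChartAt_symm_of_mem
    ((extChartAt 𝓘(ℝ, E) p).map_source hy.2)) hd.mdifferentiableAt, mfderiv_eq_fderiv] at h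
  exact DFunLike.congr_fun h v

theorem contMDiffOn_chartSymmDeriv (p : M) (v : E) :
    ContMDiffOn 𝓘(ℝ, E) (𝓘(ℝ, E).prod 𝓘(ℝ, E)) ∞
      (fun y ↦ (⟨(extChartAt 𝓘(ℝ, E) p).symm y, chartSymmDeriv p y v⟩ :
        TangentBundle 𝓘(ℝ, E) M)) (extChartAt 𝓘(ℝ, E) p).target := by
  have h1 := (contMDiffOn_extChartAt_symm (I := 𝓘(ℝ, E)) (n := ∞) p).contMDiffOn_tangentMapWithin
    (m := ∞) (by simp) (isOpen_extChartAt_target p).uniqueMDiffOn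
  have h2 : ContMDiff 𝓘(ℝ, E) (𝓘(ℝ, E).prod 𝓘(ℝ, E)) ∞
      (fun y : E ↦ (⟨y, v⟩ : TangentBundle 𝓘(ℝ, E) E)) :=
    contMDiff_vectorSpace_iff_contDiff.2 (contDiff_const (c := v))
  refine (h1.comp h2.contMDiffOn fun y hy ↦ hy).congr fun y hy ↦ ?_
  simp only [tangentMapWithin, Function.comp_apply, chartSymmDeriv]
  rw [mfderivWithin_of_isOpen (isOpen_extChartAt_target p) hy]
  rfl

variable [Bundle.RiemannianBundle (fun x : M ↦ TangentSpace 𝓘(ℝ, E) x)]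

theorem chartMetric_chartTransition {p q : M} {y : E} (hy : y ∈ chartOverlap E p q) (u v : E) :
    chartMetric q y u v =
      chartMetric p (chartTransition E p q y) (fderiv ℝ (chartTransition E p q) y u)
        (fderiv ℝ (chartTransition E p q) y v) :=
  inner_tangentSpace_congr (E := E) ((extChartAt 𝓘(ℝ, E) p).left_inv hy.2).symm _ _ _ _
    (chartSymmDeriv_eq hy u) (chartSymmDeriv_eq hy v)

theorem chartMetric_chartDerivAt {p q : M} (hq : q ∈ (extChartAt 𝓘(ℝ, E) p).source)
    (X Y : TangentSpace 𝓘(ℝ, E) q) :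
    chartMetric p (extChartAt 𝓘(ℝ, E) p q) (chartDerivAt p q X) (chartDerivAt p q Y) =
      inner ℝ X Y := by
  obtain ⟨y, hy, rfl⟩ : ∃ y ∈ (extChartAt 𝓘(ℝ, E) p).target,
      (extChartAt 𝓘(ℝ, E) p).symm y = q :=
    ⟨_, (extChartAt 𝓘(ℝ, E) p).map_source hq, (extChartAt 𝓘(ℝ, E) p).left_inv hq⟩
  rw [(extChartAt 𝓘(ℝ, E) p).right_inv hy, chartMetric_apply, chartSymmDeriv_chartDerivAt hy,
    chartSymmDeriv_chartDerivAt hy]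

theorem chartMetric_self_ne_zero {p : M} {y : E} (hy : y ∈ (extChartAt 𝓘(ℝ, E) p).target) {v : E}
    (hv : v ≠ 0) : chartMetric p y v v ≠ 0 := by
  rw [chartMetric_apply, inner_self_ne_zero]
  intro h
  apply hv
  rw [← chartDerivAt_chartSymmDeriv hy v, h, map_zero]

/-- A frame of `E` that is orthonormal for the metric read in a chart, the image of an orthonormal
basis of the tangent space. -/
theorem exists_basis_chartMetric_orthonormal [FiniteDimensional ℝ E] {p : M} {y : E}
    (hy : y ∈ (extChartAt 𝓘(ℝ, E) p).target) :
    ∃ b : Module.Basis (Fin (Module.finrank ℝ E)) ℝ E,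
      ∀ i j, chartMetric p y (b i) (b j) = if i = j then 1 else 0 := by
  obtain ⟨q, hq, rfl⟩ : ∃ q ∈ (extChartAt 𝓘(ℝ, E) p).source, extChartAt 𝓘(ℝ, E) p q = y :=
    ⟨_, (extChartAt 𝓘(ℝ, E) p).map_target hy, (extChartAt 𝓘(ℝ, E) p).right_inv hy⟩
  obtain ⟨e, he⟩ := isInvertible_chartDerivAt hq
  let o : OrthonormalBasis (Fin (Module.finrank ℝ E)) ℝ (TangentSpace 𝓘(ℝ, E) q) :=
    stdOrthonormalBasis ℝ (TangentSpace 𝓘(ℝ, E) q)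
  refine ⟨o.toBasis.map e.toLinearEquiv, fun i j ↦ ?_⟩
  have hb : ∀ i, o.toBasis.map e.toLinearEquiv i = chartDerivAt p q (o i) := by
    intro i
    rw [← he]
    simp
  rw [hb, hb, chartMetric_chartDerivAt hq, o.inner_eq_ite]

variable [IsContMDiffRiemannianBundle 𝓘(ℝ, E) ∞ E (fun x : M ↦ TangentSpace 𝓘(ℝ, E) x)]

theorem contDiffOn_chartMetric [FiniteDimensional ℝ E] (p : M) :
    ContDiffOn ℝ ∞ (chartMetric p) (extChartAt 𝓘(ℝ, E) p).target := by
  rw [contDiffOn_clm_apply]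
  intro u
  rw [contDiffOn_clm_apply]
  intro v
  rw [← contMDiffOn_iff_contDiffOn]
  exact ContMDiffOn.inner_bundle (E := fun x : M ↦ TangentSpace 𝓘(ℝ, E) x)
    (contMDiffOn_chartSymmDeriv p u) (contMDiffOn_chartSymmDeriv p v)

theorem isSmoothMetricOn_chartMetric [FiniteDimensional ℝ E] (p : M) :
    IsSmoothMetricOn (chartMetric p) (extChartAt 𝓘(ℝ, E) p).target where
  isOpen := isOpen_extChartAt_target p
  contDiffOn := contDiffOn_chartMetric p
  symm x _ u v := by
    rw [chartMetric_apply, chartMetric_apply, real_inner_comm]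
  isInvertible x hx := by
    have hinj : Function.Injective (chartMetric p x) := by
      rw [injective_iff_map_eq_zero]
      intro v hv
      by_contra hne
      exact chartMetric_self_ne_zero hx hne (by rw [hv, zero_apply])
    have hdim : Module.finrank ℝ E = Module.finrank ℝ (E →L[ℝ] ℝ) := by
      rw [← (LinearMap.toContinuousLinearMap (𝕜 := ℝ) (E := E) (F' := ℝ)).finrank_eq]
      exact (Subspace.dual_finrank_eq (K := ℝ) (V := E)).symm
    refine ⟨(LinearEquiv.ofInjectiveOfFinrankEq (chartMetric p x).toLinearMap hinj
      hdim).toContinuousLinearEquiv, ?_⟩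
    ext u v
    rfl

variable [FiniteDimensional ℝ E]

theorem isPullbackMetric_chartTransition (p q : M) :
    IsPullbackMetric (chartMetric q) (chartMetric p) (chartTransition E p q)
      (chartOverlap E p q) (extChartAt 𝓘(ℝ, E) p).target where
  source :=
    { isOpen := isOpen_chartOverlap p q
      contDiffOn := (contDiffOn_chartMetric q).mono Set.inter_subset_left
      symm := fun x hx ↦ (isSmoothMetricOn_chartMetric q).symm x hx.1
      isInvertible := fun x hx ↦ (isSmoothMetricOn_chartMetric q).isInvertible x hx.1 }
  target := isSmoothMetricOn_chartMetric p
  contDiffOn := contDiffOn_chartTransition p q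
  mapsTo _ hx := (extChartAt 𝓘(ℝ, E) p).map_source hx.2
  surjective x hx v := by
    obtain ⟨w, hw⟩ := (isInvertible_chartDerivAt hx.2).surjective v
    refine ⟨chartDerivAt q _ w, ?_⟩
    rw [fderiv_chartTransition hx, chartSymmDeriv_chartDerivAt hx.1, hw]
  apply_eq _ hx u v := chartMetric_chartTransition hx u v

/-- The curvature at `q` may be computed in any preferred chart that contains `q`. -/
theorem chartDerivAt_curvature {p q : M} (hq : q ∈ (extChartAt 𝓘(ℝ, E) p).source)
    (X Y Z : TangentSpace 𝓘(ℝ, E) q) :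
    chartDerivAt p q (curvature q X Y Z) =
      coordCurvature (chartMetric p) (extChartAt 𝓘(ℝ, E) p q) (chartDerivAt p q X)
        (chartDerivAt p q Y) (chartDerivAt p q Z) := by
  have hqq := mem_extChartAt_source (I := 𝓘(ℝ, E)) q
  have hy : extChartAt 𝓘(ℝ, E) q q ∈ chartOverlap E p q :=
    ⟨mem_extChartAt_target (I := 𝓘(ℝ, E)) q, by simpa using hq⟩
  have h := (isPullbackMetric_chartTransition p q).apply_coordCurvature hy (chartDeriv q X)
    (chartDeriv q Y) (chartDeriv q Z)
  have hinv : (chartDeriv q).IsInvertible := isInvertible_chartDerivAt hqq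
  have hφ : chartTransition E p q (extChartAt 𝓘(ℝ, E) q q) = extChartAt 𝓘(ℝ, E) p q := by
    simp [chartTransition]
  rw [← fderiv_chartTransition_chartDeriv hq, ← fderiv_chartTransition_chartDeriv hq,
    ← fderiv_chartTransition_chartDeriv hq, ← fderiv_chartTransition_chartDeriv hq, ← hφ, ← h,
    curvature]
  congr 1
  exact hinv.self_apply_inverse _

theorem ricci_eq_coordRicci {p q : M} (hq : q ∈ (extChartAt 𝓘(ℝ, E) p).source)
    (Y Z : TangentSpace 𝓘(ℝ, E) q) :
    ricci q Y Z = coordRicci (chartMetric p) (extChartAt 𝓘(ℝ, E) p q) (chartDerivAt p q Y)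
      (chartDerivAt p q Z) := by
  obtain ⟨e, he⟩ := isInvertible_chartDerivAt hq
  rw [ricci, coordRicci, ← LinearMap.trace_conj' _ e.toLinearEquiv]
  congr 1
  ext v
  obtain ⟨X, rfl⟩ := e.surjective v
  have h := chartDerivAt_curvature hq X Y Z
  rw [← he] at h ⊢
  have e1 : e.toLinearEquiv.symm (e X) = X := e.symm_apply_apply X
  rw [LinearEquiv.conj_apply_apply, e1]
  exact h

end Charts

/-! ### The Ricci operator and higher order Jacobi operators -/

section RicciOperator

variable {E : Type*} [NormedAddCommGroup E] [NormedSpace ℝ E]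
  {M : Type*} [TopologicalSpace M] [ChartedSpace E M]
  [Bundle.RiemannianBundle (fun x : M ↦ TangentSpace 𝓘(ℝ, E) x)]

/-- The `(0,4)` curvature tensor at `p` as a quadrilinear map. -/
noncomputable def curvatureTensor (p : M) :
    TangentSpace 𝓘(ℝ, E) p →ₗ[ℝ] TangentSpace 𝓘(ℝ, E) p →ₗ[ℝ] TangentSpace 𝓘(ℝ, E) p →ₗ[ℝ]
      TangentSpace 𝓘(ℝ, E) p →ₗ[ℝ] ℝ :=
  LinearMap.mk₂ ℝ
    (fun X Y ↦ LinearMap.mk₂ ℝ (fun Z U ↦ curvatureForm p X Y Z U)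
      (fun Z Z' U ↦ by simp [curvatureForm, curvature, inner_add_left])
      (fun c Z U ↦ by simp [curvatureForm, curvature, real_inner_smul_left])
      (fun Z U U' ↦ by simp [curvatureForm, inner_add_right])
      (fun c Z U ↦ by simp [curvatureForm, real_inner_smul_right]))
    (fun X X' Y ↦ by ext Z U; simp [curvatureForm, curvature, inner_add_left])
    (fun c X Y ↦ by ext Z U; simp [curvatureForm, curvature, real_inner_smul_left])
    (fun X Y Y' ↦ by ext Z U; simp [curvatureForm, curvature, inner_add_left])
    (fun c X Y ↦ by ext Z U; simp [curvatureForm, curvature, real_inner_smul_left])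

theorem jacobi_smul (p : M) (c : ℝ) (X : TangentSpace 𝓘(ℝ, E) p) :
    jacobi p (c • X) = (c * c) • jacobi p X := by
  ext U
  simp [jacobi, curvatureEnd, curvature, smul_smul]

theorem inner_jacobi (p : M) (X U Z : TangentSpace 𝓘(ℝ, E) p) :
    inner ℝ (jacobi p X U) Z = curvatureTensor p U X X Z := rfl

variable [FiniteDimensional ℝ E]

theorem higherJacobi_span {ι : Type*} [Fintype ι] (p : M) {v : ι → TangentSpace 𝓘(ℝ, E) p}
    (hv : Orthonormal ℝ v) :
    higherJacobi p (Submodule.span ℝ (Set.range v)) = ∑ i, jacobi p (v i) := by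
  have hb : Orthonormal ℝ (Module.Basis.span hv.linearIndependent) := by
    rw [← (Submodule.span ℝ (Set.range v)).subtypeₗᵢ.orthonormal_comp_iff]
    convert hv using 1
    ext i
    simp [Module.Basis.span_apply]
  rw [higherJacobi_eq_sum p _ ((Module.Basis.span hv.linearIndependent).toOrthonormalBasis hb)]
  simp [Module.Basis.span_apply]

theorem higherJacobi_span_singleton (p : M) {X : TangentSpace 𝓘(ℝ, E) p} (hX : ‖X‖ = 1) :
    higherJacobi p (Submodule.span ℝ {X}) = jacobi p X := by
  have h := higherJacobi_span p (v := fun _ : Unit ↦ X) ⟨fun _ ↦ hX, fun i j hij ↦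
    absurd (Subsingleton.elim i j) hij⟩
  simpa using h

/-- The bilinear map `(Y, Z) ↦ (X ↦ R(X, Y) Z)`. -/
noncomputable def curvatureEndBilin (p : M) :
    TangentSpace 𝓘(ℝ, E) p →ₗ[ℝ] TangentSpace 𝓘(ℝ, E) p →ₗ[ℝ]
      Module.End ℝ (TangentSpace 𝓘(ℝ, E) p) :=
  LinearMap.mk₂ ℝ (fun Y Z ↦ curvatureEnd p Y Z)
    (fun Y Y' Z ↦ by ext X; simp [curvatureEnd, curvature])
    (fun c Y Z ↦ by ext X; simp [curvatureEnd, curvature])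
    (fun Y Z Z' ↦ by ext X; simp [curvatureEnd, curvature])
    (fun c Y Z ↦ by ext X; simp [curvatureEnd, curvature])

/-- `J(W)` as the contraction of `R` with the orthogonal projection onto `W`. -/
theorem higherJacobi_eq_sum_starProjection {ι : Type*} [Fintype ι] (p : M)
    (W : Submodule ℝ (TangentSpace 𝓘(ℝ, E) p))
    (e : OrthonormalBasis ι ℝ (TangentSpace 𝓘(ℝ, E) p)) :
    higherJacobi p W = ∑ k, curvatureEndBilin p (W.starProjection (e k)) (e k) := by
  let b := stdOrthonormalBasis ℝ W
  change ∑ i, curvatureEndBilin p (b i : TangentSpace 𝓘(ℝ, E) p) (b i) = _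
  have h1 : ∀ k, W.starProjection (e k) =
      ∑ i, inner ℝ (b i : TangentSpace 𝓘(ℝ, E) p) (e k) • (b i : TangentSpace 𝓘(ℝ, E) p) := by
    intro k
    rw [Submodule.starProjection_apply]
    conv_lhs => rw [← b.sum_repr' (W.orthogonalProjectionOnto (e k))]
    simp
  have h2 : ∀ i, curvatureEndBilin p (b i : TangentSpace 𝓘(ℝ, E) p) (b i) =
      ∑ k, inner ℝ (b i : TangentSpace 𝓘(ℝ, E) p) (e k) •
        curvatureEndBilin p (b i : TangentSpace 𝓘(ℝ, E) p) (e k) := by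
    intro i
    have h := congrArg (curvatureEndBilin p (b i : TangentSpace 𝓘(ℝ, E) p))
      (e.sum_repr' (b i : TangentSpace 𝓘(ℝ, E) p)).symm
    rw [map_sum] at h
    exact h.trans <| Finset.sum_congr rfl fun k _ ↦ by rw [map_smul, real_inner_comm]
  simp only [h1, h2, map_sum, LinearMap.sum_apply, map_smul, LinearMap.smul_apply]
  rw [Finset.sum_comm]

theorem higherJacobi_add_orthogonal (p : M) (W : Submodule ℝ (TangentSpace 𝓘(ℝ, E) p)) :
    higherJacobi p W + higherJacobi p Wᗮ = higherJacobi p ⊤ := by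
  have e := stdOrthonormalBasis ℝ (TangentSpace 𝓘(ℝ, E) p)
  simp only [higherJacobi_eq_sum_starProjection p _ e, ← Finset.sum_add_distrib]
  refine Finset.sum_congr rfl fun k _ ↦ ?_
  rw [← LinearMap.add_apply, ← map_add,
    Submodule.starProjection_add_starProjection_orthogonal (K := W), Submodule.starProjection_top,
    ContinuousLinearMap.id_apply]

/-- As `J(Wᗮ) = ρ - J(W)` with `ρ` the Ricci operator, commuting with `J(Wᗮ)` amounts to
commuting with `ρ`. -/
theorem commute_higherJacobi_orthogonal_iff (p : M)
    (W : Submodule ℝ (TangentSpace 𝓘(ℝ, E) p)) :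
    Commute (higherJacobi p W) (higherJacobi p Wᗮ) ↔
      Commute (higherJacobi p W) (higherJacobi p ⊤) := by
  rw [← higherJacobi_add_orthogonal p W]
  refine ⟨fun h ↦ (Commute.refl _).add_right h, fun h ↦ ?_⟩
  simpa using h.sub_right (Commute.refl (higherJacobi p W))

/-- The Jacobi operator of a unit vector is a combination of the Jacobi operators of three planes;
so if the latter commute with the Ricci operator, so does the former. -/
theorem commute_jacobi_of_commute_plane (hn : 3 ≤ Module.finrank ℝ E) {p : M}
    {T : Module.End ℝ (TangentSpace 𝓘(ℝ, E) p)}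
    (h : ∀ α : Submodule ℝ (TangentSpace 𝓘(ℝ, E) p), Module.finrank ℝ α = 2 →
      Commute (higherJacobi p α) T)
    {X : TangentSpace 𝓘(ℝ, E) p} (hX : ‖X‖ = 1) : Commute (jacobi p X) T := by
  let i₀ : Fin (Module.finrank ℝ E) := ⟨0, by omega⟩
  let i₁ : Fin (Module.finrank ℝ E) := ⟨1, by omega⟩
  let i₂ : Fin (Module.finrank ℝ E) := ⟨2, by omega⟩
  obtain ⟨b, hb⟩ : ∃ b : OrthonormalBasis (Fin (Module.finrank ℝ E)) ℝ
      (TangentSpace 𝓘(ℝ, E) p), b i₀ = X := by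
    have hv : Orthonormal ℝ (Set.domRestrict {i₀} fun _ : Fin (Module.finrank ℝ E) ↦ X) :=
      ⟨fun _ ↦ hX, fun i j hij ↦ absurd (Subsingleton.elim i j) hij⟩
    obtain ⟨b, hb⟩ := hv.exists_orthonormalBasis_extension_of_card_eq
      (show Module.finrank ℝ E = _ by simp)
    exact ⟨b, hb i₀ rfl⟩
  have plane : ∀ i j, i ≠ j → Commute (jacobi p (b i) + jacobi p (b j)) T := by
    intro i j hij
    have ho : Orthonormal ℝ (b ∘ ![i, j]) := b.orthonormal.comp _ (by
      intro k k' hk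
      fin_cases k <;> fin_cases k' <;> simp_all)
    have h2 := h _ (finrank_span_eq_card ho.linearIndependent)
    rw [higherJacobi_span p ho] at h2
    simpa using h2
  have h01 := plane i₀ i₁ (by simp [i₀, i₁])
  have h02 := plane i₀ i₂ (by simp [i₀, i₂])
  have h12 := plane i₁ i₂ (by simp [i₁, i₂])
  have e : jacobi p X = (1 / 2 : ℝ) • ((jacobi p (b i₀) + jacobi p (b i₁)) +
      (jacobi p (b i₀) + jacobi p (b i₂)) - (jacobi p (b i₁) + jacobi p (b i₂))) := by
    rw [hb]
    module
  rw [e]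
  exact ((h01.add_left h02).sub_left h12).smul_left _

variable [IsManifold 𝓘(ℝ, E) ∞ M]
  [IsContMDiffRiemannianBundle 𝓘(ℝ, E) ∞ E (fun x : M ↦ TangentSpace 𝓘(ℝ, E) x)]

theorem isAlgCurvature_curvatureTensor (p : M) :
    IsAlgCurvature (curvatureTensor (E := E) p) := by
  have hp := mem_extChartAt_source (I := 𝓘(ℝ, E)) p
  have ht := mem_extChartAt_target (I := 𝓘(ℝ, E)) p
  have hG := isSmoothMetricOn_chartMetric (E := E) p
  have inj := (isInvertible_chartDerivAt (E := E) hp).injective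
  have R := chartDerivAt_curvature (E := E) hp
  have form : ∀ X Y Z U, curvatureTensor (E := E) p X Y Z U =
      chartMetric p (extChartAt 𝓘(ℝ, E) p p) (coordCurvature (chartMetric p)
        (extChartAt 𝓘(ℝ, E) p p) (chartDerivAt p p X) (chartDerivAt p p Y)
        (chartDerivAt p p Z)) (chartDerivAt p p U) := by
    intro X Y Z U
    rw [← R, chartMetric_chartDerivAt hp]
    rfl
  refine ⟨fun X Y Z U ↦ ?_, fun X Y Z U ↦ ?_, fun X Y Z U ↦ ?_⟩
  · rw [form, form, coordCurvature_swap, map_neg, neg_apply]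
  · rw [form, form, hG.coordCurvature_skew ht]
  · rw [form, form, form, ← add_apply, ← add_apply, ← map_add, ← map_add,
      hG.coordCurvature_bianchi ht, map_zero, zero_apply]

/-- `J(T_pM)` is the Ricci operator. -/
theorem inner_higherJacobi_top (p : M) (U Z : TangentSpace 𝓘(ℝ, E) p) :
    inner ℝ (higherJacobi p ⊤ U) Z = ricci p U Z := by
  have h := isAlgCurvature_curvatureTensor (E := E) p
  have e := stdOrthonormalBasis ℝ (TangentSpace 𝓘(ℝ, E) p)
  rw [higherJacobi_eq_sum_starProjection p _ e, ricci, LinearMap.trace_eq_sum_inner _ e,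
    LinearMap.sum_apply, sum_inner]
  refine Finset.sum_congr rfl fun k _ ↦ ?_
  rw [Submodule.starProjection_top, real_inner_comm _ (e k)]
  change curvatureTensor p U (e k) (e k) Z = curvatureTensor p (e k) U Z (e k)
  rw [h.swap_left, h.swap_right, neg_neg]

theorem isSymmetric_higherJacobi_top (p : M) :
    (higherJacobi (E := E) p ⊤).IsSymmetric := by
  intro U Z
  have h := isAlgCurvature_curvatureTensor (E := E) p
  have e := stdOrthonormalBasis ℝ (TangentSpace 𝓘(ℝ, E) p)
  rw [real_inner_comm _ U, inner_higherJacobi_top, inner_higherJacobi_top, ricci, ricci,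
    LinearMap.trace_eq_sum_inner _ e, LinearMap.trace_eq_sum_inner _ e]
  refine Finset.sum_congr rfl fun k _ ↦ ?_
  rw [real_inner_comm _ (e k), real_inner_comm _ (e k)]
  exact h.pair_symm (e k) U Z (e k) |>.trans (by
    rw [h.swap_left, h.swap_right, neg_neg]; rfl)

/-- If all Jacobi operators commute with the Ricci operator, then, the curvature being
indecomposable, the Ricci operator is a multiple of the identity. -/
theorem exists_ricci_eq_of_commute [Nontrivial E] (p : M) (hp : ¬ IsDecomposableAt (E := E) p)
    (hc : ∀ X : TangentSpace 𝓘(ℝ, E) p, ‖X‖ = 1 →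
      Commute (jacobi p X) (higherJacobi p ⊤)) :
    ∃ c : ℝ, ∀ Y Z : TangentSpace 𝓘(ℝ, E) p, ricci p Y Z = c * inner ℝ Y Z := by
  have : Nontrivial (TangentSpace 𝓘(ℝ, E) p) := ‹Nontrivial E›
  have hρ := isSymmetric_higherJacobi_top (E := E) p
  have hc' : ∀ X : TangentSpace 𝓘(ℝ, E) p, Commute (jacobi p X) (higherJacobi p ⊤) := by
    intro X
    by_cases hX : X = 0
    · have := jacobi_smul p 0 (0 : TangentSpace 𝓘(ℝ, E) p)
      rw [hX]
      simp only [smul_zero, mul_zero, zero_smul] at this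
      rw [this]
      exact Commute.zero_left _
    · have h := (hc _ (norm_smul_inv_norm (𝕜 := ℝ) hX)).smul_left (‖X‖ * ‖X‖)
      rw [← jacobi_smul, smul_smul] at h
      simpa [hX] using h
  rcases (isAlgCurvature_curvatureTensor (E := E) p).exists_eq_smul_or_splits hρ
    (fun A B X ↦ by
      rw [← inner_jacobi, ← inner_jacobi, ← hρ]
      exact congrArg (fun v ↦ inner ℝ v B) (DFunLike.congr_fun (hc' X).eq A)) with ⟨c, h⟩ | h
  · refine ⟨c, fun Y Z ↦ ?_⟩
    rw [← inner_higherJacobi_top, h, real_inner_smul_left]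
  · exact absurd h hp

end RicciOperator

/-! ### Schur's lemma on a connected manifold -/

section SchurManifold

variable {E : Type*} [NormedAddCommGroup E] [NormedSpace ℝ E] [FiniteDimensional ℝ E]
  {M : Type*} [TopologicalSpace M] [ChartedSpace E M]
  [Bundle.RiemannianBundle (fun x : M ↦ TangentSpace 𝓘(ℝ, E) x)]
  [IsManifold 𝓘(ℝ, E) ∞ M]
  [IsContMDiffRiemannianBundle 𝓘(ℝ, E) ∞ E (fun x : M ↦ TangentSpace 𝓘(ℝ, E) x)]

/-- **Schur's lemma**: in dimension other than two a metric whose Ricci tensor is a multiple of the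
metric at each point is Einstein. -/
theorem isEinstein_of_forall_exists_ricci_eq [ConnectedSpace M] [Nontrivial E]
    (hn : Module.finrank ℝ E ≠ 2)
    (h : ∀ p : M, ∃ c : ℝ, ∀ Y Z : TangentSpace 𝓘(ℝ, E) p, ricci p Y Z = c * inner ℝ Y Z) :
    IsEinstein E M := by
  choose l hl using h
  suffices hloc : IsLocallyConstant l by
    obtain ⟨p₀⟩ : Nonempty M := inferInstance
    exact ⟨l p₀, fun p Y Z ↦ by rw [hl, hloc.apply_eq_of_preconnectedSpace p p₀]⟩
  rw [IsLocallyConstant.iff_eventually_eq]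
  intro p
  set T := (extChartAt 𝓘(ℝ, E) p).target with hT
  have hG := isSmoothMetricOn_chartMetric (E := E) p
  let f : E → ℝ := fun y ↦ l ((extChartAt 𝓘(ℝ, E) p).symm y)
  have hric : ∀ y ∈ T, ∀ v z, coordRicci (chartMetric p) y v z = f y * chartMetric p y v z := by
    intro y hy v z
    have hq := (extChartAt 𝓘(ℝ, E) p).map_target hy
    obtain ⟨Y, rfl⟩ := (isInvertible_chartDerivAt hq).surjective v
    obtain ⟨Z, rfl⟩ := (isInvertible_chartDerivAt hq).surjective z
    have h1 := ricci_eq_coordRicci hq Y Z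
    have h2 := chartMetric_chartDerivAt hq Y Z
    rw [(extChartAt 𝓘(ℝ, E) p).right_inv hy] at h1 h2
    rw [← h1, h2, hl]
  -- `f` is the quotient of a component of the Ricci tensor by one of the metric
  obtain ⟨v, hv⟩ := exists_ne (0 : E)
  have hf : ∀ y ∈ T, DifferentiableAt ℝ f y := by
    intro y hy
    have hne := chartMetric_self_ne_zero hy hv
    have d1 : DifferentiableAt ℝ (fun y ↦ chartMetric p y v v) y :=
      ((hG.differentiableAt hy).clm_apply (differentiableAt_const v)).clm_apply
        (differentiableAt_const v)
    have d2 : DifferentiableAt ℝ (fun y ↦ coordRicci (chartMetric p) y v v) y := by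
      let L : (E →L[ℝ] E →L[ℝ] E →L[ℝ] E) →ₗ[ℝ] ℝ :=
        { toFun := fun F ↦ LinearMap.trace ℝ E ((F.flip v).flip v : E →L[ℝ] E)
          map_add' := fun F F' ↦ by
            rw [← map_add]
            rfl
          map_smul' := fun c F ↦ by
            rw [← map_smul]
            rfl }
      exact (LinearMap.toContinuousLinearMap L).differentiableAt.comp y
        (hG.differentiableAt_coordCurvature hy)
    refine (d2.fun_mul (d1.fun_inv hne)).congr_of_eventuallyEq ?_
    filter_upwards [hG.isOpen.mem_nhds hy] with z hz
    rw [← div_eq_mul_inv, hric z hz, mul_div_cancel_right₀ _ (chartMetric_self_ne_zero hz hv)]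
  have hf' : ∀ y ∈ T, fderiv ℝ f y = 0 := by
    intro y hy
    obtain ⟨b, hb⟩ := exists_basis_chartMetric_orthonormal hy
    exact hG.fderiv_eq_zero_of_ricci_eq hy (hf y hy) hric b hb (by simpa using hn)
  obtain ⟨r, hr, hball⟩ := Metric.isOpen_iff.1 hG.isOpen _ (mem_extChartAt_target p)
  filter_upwards [(isOpen_extChartAt_source (I := 𝓘(ℝ, E)) p).mem_nhds (mem_extChartAt_source p),
    (continuousAt_extChartAt (I := 𝓘(ℝ, E)) p).preimage_mem_nhds (Metric.ball_mem_nhds _ hr)]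
    with q hq hqr
  have := Metric.isOpen_ball.is_const_of_fderiv_eq_zero (𝕜 := ℝ) (convex_ball _ r).isPreconnected
    (fun y hy ↦ (hf y (hball hy)).differentiableWithinAt) (fun y hy ↦ hf' y (hball hy)) hqr
    (Metric.mem_ball_self hr)
  simpa only [f, (extChartAt 𝓘(ℝ, E) p).left_inv hq,
    (extChartAt 𝓘(ℝ, E) p).left_inv (mem_extChartAt_source p)] using this

theorem commute_higherJacobi_top_of_isEinstein (h : IsEinstein E M) (p : M)
    (T : Module.End ℝ (TangentSpace 𝓘(ℝ, E) p)) : Commute T (higherJacobi p ⊤) := by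
  obtain ⟨c, hc⟩ := h
  have : higherJacobi p ⊤ = c • (1 : Module.End ℝ (TangentSpace 𝓘(ℝ, E) p)) := by
    ext U
    refine ext_inner_right ℝ fun Z ↦ ?_
    rw [inner_higherJacobi_top, hc, LinearMap.smul_apply, real_inner_smul_left,
      Module.End.one_apply]
  rw [this]
  exact (Commute.one_right T).smul_right c

end SchurManifold

theorem theorem2p2 {M : Type*} [TopologicalSpace M] [ConnectedSpace M]
    [ChartedSpace (EuclideanSpace ℝ (Fin 4)) M] [IsManifold (𝓡 4) ∞ M]
    [Bundle.RiemannianBundle (fun x : M ↦ TangentSpace (𝓡 4) x)]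
    [IsContMDiffRiemannianBundle (𝓡 4) ∞ (EuclideanSpace ℝ (Fin 4))
      (fun x : M ↦ TangentSpace (𝓡 4) x)]
    (hM : RiemGeom.IsIndecomposable (EuclideanSpace ℝ (Fin 4)) M) :
    List.TFAE [
      ∀ (p : M) (X : TangentSpace (𝓡 4) p), ‖X‖ = 1 →
        Commute (RiemGeom.jacobi p X) (RiemGeom.higherJacobi p (Submodule.span ℝ {X})ᗮ),
      ∀ (p : M) (α : Submodule ℝ (TangentSpace (𝓡 4) p)), Module.finrank ℝ α = 2 →
        Commute (RiemGeom.higherJacobi p α) (RiemGeom.higherJacobi p αᗮ),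
      RiemGeom.IsEinstein (EuclideanSpace ℝ (Fin 4)) M] := by
  have hline : ∀ (p : M) (X : TangentSpace (𝓡 4) p), ‖X‖ = 1 →
      (Commute (jacobi p X) (higherJacobi p (Submodule.span ℝ {X})ᗮ) ↔
        Commute (jacobi p X) (higherJacobi p ⊤)) := fun p X hX ↦ by
    have h := commute_higherJacobi_orthogonal_iff p (Submodule.span ℝ {X})
    rwa [higherJacobi_span_singleton p hX] at h
  tfae_have 1 → 3 := fun h ↦
    isEinstein_of_forall_exists_ricci_eq (by simp) fun p ↦
      exists_ricci_eq_of_commute p (hM p) fun X hX ↦ (hline p X hX).1 (h p X hX)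
  tfae_have 3 → 2 := fun h p α _ ↦
    (commute_higherJacobi_orthogonal_iff p α).2 (commute_higherJacobi_top_of_isEinstein h p _)
  tfae_have 2 → 1 := fun h p X hX ↦
    (hline p X hX).2 <| commute_jacobi_of_commute_plane (by simp)
      (fun α hα ↦ (commute_higherJacobi_orthogonal_iff p α).1 (h p α hα)) hX
  tfae_finish
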